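/- Let $n\ge 1$, let $0\le\theta_1<\theta_2<\cdots<\theta_n<2\pi$, let $m_1,\dots,m_n\ge 1$ be integers and put $N=\sum_{l=1}^n m_l$. Let $A$ be a fixed $N\times N$ diagonal unitary matrix with diagonal entries $e^{i\theta_l}$, each repeated $m_l$ times. Let $t=e^{i\phi}$ with $0<\phi<2\pi$ (so $|t|=1$, $t\ne1$), and let $B=\mathrm{diag}(t,1,\dots,1)$. Let $U,V$ be independent random elements of $U(N)$, each distributed according to the normalised Haar measure. Then almost surely the random unitary matrix $UAU^\dagger VBV^\dagger$ has each $e^{i\theta_l}$ as an eigenvalue of multiplicity exactly $m_l-1$ (multiplicity $0$ meaning that it is not an eigenvalue). The remaining $n$ eigenvalues can be written almost surely as $e^{i\psi_1},\dots,e^{i\psi_n}$, with real random variables $\psi_j$ that satisfy, with $\theta_0:=\theta_n-2\pi$, $$\theta_{j-1}<\psi_j<\theta_j\quad(j=1,\dots,n),\qquad \prod_{l=1}^n e^{i\psi_l}=t\prod_{l=1}^n e^{i\theta_l}.$$ The product constraint and the interlacing together force $\sum_{l=1}^n\psi_l=\phi-2\pi+\sum_{l=1}^n\theta_l$. With respect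 to the Lebesgue measure $d\psi_1\cdots d\psi_{n-1}$ on this hyperplane ($\psi_n$ being determined by the others), the joint law of $(\psi_1,\dots,\psi_n)$ has the density that vanishes outside the interlacing region $\{\theta_{j-1}<\psi_j<\theta_j,\ j=1,\dots,n\}$ and equals on that region $$\frac{\Gamma(m_1+\cdots+m_n)}{\Gamma(m_1)\cdots\Gamma(m_n)}\,\frac{1}{|1-t|^{N-1}}\;\frac{\prod_{1\le j<k\le n}|e^{i\psi_k}-e^{i\psi_j}|}{\prod_{1\le j<k\le n}|e^{i\theta_k}-e^{i\theta_j}|^{m_j+m_k-1}}\;\prod_{j=1}^n\prod_{p=1}^n|e^{i\theta_j}-e^{i\psi_p}|^{m_j-1}.$$ (For $n=1$ the law is the unit point mass at $\psi_1=\phi-2\pi+\theta_1$.) -/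

import Mathlib

open MeasureTheory ProbabilityTheory

namespace MultHorn

noncomputable section

/-- The point `e^{ix}` of the unit circle. -/
def e (x : ℝ) : ℂ := Complex.exp (x * Complex.I)

/-- The diagonal matrix whose `i`-th diagonal entry is `e^{iθ_{c(i)}}`; the map `c` tells which
of the `k + 1` distinct eigenvalues stands at position `i`, so that `e^{iθ_l}` is repeated as often
as `c` takes the value `l`. -/
def diagA {N k : ℕ} (θ : Fin (k + 1) → ℝ) (c : Fin N → Fin (k + 1)) :
    Matrix (Fin N) (Fin N) ℂ :=
  Matrix.diagonal fun i => e (θ (c i))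

/-- The `N × N` matrix `diag(t, 1, …, 1)`. -/
def diagB (N : ℕ) (t : ℂ) : Matrix (Fin N) (Fin N) ℂ :=
  Matrix.diagonal fun i => if i.val = 0 then t else 1

/-- The product `U A U† V B V†`. -/
def product {N : ℕ} (A B : Matrix (Fin N) (Fin N) ℂ) (U V : Matrix.unitaryGroup (Fin N) ℂ) :
    Matrix (Fin N) (Fin N) ℂ :=
  (U : Matrix (Fin N) (Fin N) ℂ) * A * (U : Matrix (Fin N) (Fin N) ℂ).conjTranspose *
    (V : Matrix (Fin N) (Fin N) ℂ) * B * (V : Matrix (Fin N) (Fin N) ℂ).conjTranspose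

/-- The cyclic predecessor of the angle `θ_i`: it is `θ_{i-1}` for every index but the first, and
for the first index it is the last angle, lowered by `2π`. -/
def prevAngle {k : ℕ} (θ : Fin (k + 1) → ℝ) : Fin (k + 1) → ℝ :=
  Fin.cons (θ (Fin.last k) - 2 * Real.pi) fun j : Fin k => θ j.castSucc

/-- Interlacing on the circle: `θ_{i-1} < ψ_i < θ_i` for all `i`. -/
def Interlaces {k : ℕ} (θ ψ : Fin (k + 1) → ℝ) : Prop :=
  ∀ i, prevAngle θ i < ψ i ∧ ψ i < θ i

/-- Lebesgue measure `dψ_1 ⋯ dψ_k` on the hyperplane `ψ_1 + ⋯ + ψ_{k+1} = s`, the last variable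
being a function of the others. -/
def hyperplaneVolume (k : ℕ) (s : ℝ) : Measure (Fin (k + 1) → ℝ) :=
  Measure.map (fun x : Fin k → ℝ => (Fin.snoc x (s - ∑ j, x j) : Fin (k + 1) → ℝ)) volume

/-- The formula for the eigenvalue density, as a function of the angles `ψ_j`. -/
def eigenWeight {k : ℕ} (m : Fin (k + 1) → ℕ) (θ : Fin (k + 1) → ℝ) (t : ℂ)
    (ψ : Fin (k + 1) → ℝ) : ℝ :=
  (Real.Gamma ((∑ l, m l : ℕ) : ℝ) / ∏ l, Real.Gamma (m l : ℝ)) *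
    (1 / ‖1 - t‖ ^ ((∑ l, m l) - 1)) *
    ((∏ j, ∏ l ∈ Finset.Ioi j, ‖e (ψ l) - e (ψ j)‖) /
      (∏ j, ∏ l ∈ Finset.Ioi j, ‖e (θ l) - e (θ j)‖ ^ (m j + m l - 1))) *
    ∏ j, ∏ p, ‖e (θ j) - e (ψ p)‖ ^ (m j - 1)

open Classical in
/-- The density of the angles, supported on the interlacing region. -/
def eigenDensity {k : ℕ} (m : Fin (k + 1) → ℕ) (θ : Fin (k + 1) → ℝ) (t : ℂ)
    (ψ : Fin (k + 1) → ℝ) : ENNReal :=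
  if Interlaces θ ψ then ENNReal.ofReal (eigenWeight m θ t ψ) else 0

end

end MultHorn

/-!
The argument reduces the statement to a deterministic change of variables.

Up to conjugation by `U`, the random matrix is `A (1 + (t - 1) w w†)`, where `w` is the first column
of `U† V`. By the matrix determinant lemma (`charpoly_rank_one`), its characteristic polynomial is
`∏ (X - e^{iθ_l}) ^ (m_l - 1)` times a polynomial of degree `n`, the secular polynomial, which
depends on `w` only through the weights `q_l`, the squared norms of the components of `w` in the
eigenspaces of `A`.

* *The map from weights to angles.* On the unit circle the secular polynomial is a phase times a
  real function that changes sign from one angle `θ_{j-1}` to the next angle `θ_j`. Hence it has one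
  root `e^{iψ_j}` in each gap. Conversely, evaluation at the points `e^{iθ_j}` recovers the weights
  from the roots, as ratios of products of chords (`weight`). So interlacing sequences on the
  hyperplane `∑ ψ_l = φ - 2π + ∑ θ_l` correspond bijectively to points of the open simplex
  (`image_weightMap`, `injOn_weightMap`).
* *The Jacobian.* The derivative of the weights with respect to the angles is, up to factors
  attached to rows and columns, the matrix of the values of the Lagrange polynomials
  `∏_{p' ≠ p} (X - e^{iψ_{p'}})` at the `e^{iθ_j}`; its determinant is a product of two Vandermonde
  determinants (`norm_det_lagrange`, `abs_det_jacobian`).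
* *The law of the weights.* A column of a Haar unitary matrix is distributed like `z / ‖z‖`, with
  `z` uniform in the unit ball of `ℂ^N` (`lintegral_column_mul_volume`). The squared norms of the
  blocks of `z` have a joint density proportional to `∏ s_l ^ (m_l - 1)`, and integrating out the
  total `∑ s_l` leaves the Dirichlet distribution with parameters `m_l`
  (`lintegral_weights_column`).

The Dirichlet density times the Jacobian is the density of the statement
(`abs_det_mul_dirichletWeight`), and the change of variables formula concludes.
-/

open Polynomial

namespace MultHorn

/-! ### Chords of the unit circle -/

/-- The signed length `2 sin (x / 2)` of the chord of the unit circle subtended by the angle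
`x`. -/
noncomputable def chord (x : ℝ) : ℝ := 2 * Real.sin (x / 2)

lemma e_add (x y : ℝ) : e (x + y) = e x * e y := by
  simp [e, add_mul, Complex.exp_add]

lemma e_ne_zero (x : ℝ) : e x ≠ 0 := Complex.exp_ne_zero _

lemma norm_e (x : ℝ) : ‖e x‖ = 1 := Complex.norm_exp_ofReal_mul_I x

@[simp] lemma e_zero : e 0 = 1 := by simp [e]

lemma e_sum {ι : Type*} (s : Finset ι) (f : ι → ℝ) : e (∑ i ∈ s, f i) = ∏ i ∈ s, e (f i) := by
  simp [e, Finset.sum_mul, Complex.exp_sum]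

lemma e_half_mul_self (x : ℝ) : e (x / 2) * e (x / 2) = e x := by
  rw [← e_add, add_halves]

lemma e_neg_pi : e (-Real.pi) = -1 := by
  simp [e, Complex.exp_neg, Complex.exp_pi_mul_I]

lemma e_eq_e_iff {x y : ℝ} : e x = e y ↔ ∃ n : ℤ, x = y + n * (2 * Real.pi) := by
  rw [e, e, Complex.exp_eq_exp_iff_exists_int]
  refine exists_congr fun n => ?_
  rw [← Complex.ofReal_inj]
  push_cast
  constructor
  · intro h
    have : (x : ℂ) * Complex.I = (y + n * (2 * Real.pi)) * Complex.I := by rw [h]; ring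
    exact mul_right_cancel₀ Complex.I_ne_zero this
  · intro h; rw [h]; ring

lemma e_inj_of_abs_sub_lt {x y : ℝ} (h : |x - y| < 2 * Real.pi) (hxy : e x = e y) : x = y := by
  obtain ⟨n, hn⟩ := e_eq_e_iff.1 hxy
  have hpi := Real.two_pi_pos
  have h1 : |(n : ℝ)| * (2 * Real.pi) < 1 * (2 * Real.pi) := by
    rw [hn, add_sub_cancel_left, abs_mul, abs_of_pos hpi] at h
    simpa using h
  have h2 := lt_of_mul_lt_mul_right h1 hpi.le
  have h3 : n = 0 := Int.abs_lt_one_iff.1 (by exact_mod_cast h2)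
  simpa [h3] using hn

/-- A difference of two points of the unit circle is a phase times a signed chord. This turns the
complex products below into real ones with a sign that can be read off. -/
lemma e_sub_e (x y : ℝ) :
    e x - e y = Complex.I * e (x / 2) * e (y / 2) * chord (x - y) := by
  have hx := e_half_mul_self x
  have hy := e_half_mul_self y
  have h1 : e (x / 2) = e (y / 2) * e ((x - y) / 2) := by rw [← e_add]; congr 1; ring
  have h2 : e ((x - y) / 2) * e (-((x - y) / 2)) = 1 := by rw [← e_add]; simp
  have h3 : (chord (x - y) : ℂ) = (e (-((x - y) / 2)) - e ((x - y) / 2)) * Complex.I := by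
    simp only [chord, e]
    push_cast
    rw [Complex.sin]
    ring_nf
  rw [h3, ← hx, ← hy]
  linear_combination (-e (x / 2) * e (y / 2) * (e (-((x - y) / 2)) - e ((x - y) / 2))) *
    Complex.I_mul_I + (e (x / 2) + e (y / 2) * e (-((x - y) / 2))) * h1 + e (y / 2)^2 * h2

lemma norm_e_sub_e (x y : ℝ) : ‖e x - e y‖ = |chord (x - y)| := by
  rw [e_sub_e]; simp [norm_e]

lemma chord_neg (x : ℝ) : chord (-x) = -chord x := by simp [chord, neg_div]

lemma chord_pos {x : ℝ} (h0 : 0 < x) (h1 : x < 2 * Real.pi) : 0 < chord x :=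
  mul_pos two_pos (Real.sin_pos_of_pos_of_lt_pi (by linarith) (by linarith))

lemma chord_neg_of_neg {x : ℝ} (h0 : x < 0) (h1 : -(2 * Real.pi) < x) : chord x < 0 := by
  have := chord_pos (x := -x) (by linarith) (by linarith)
  rw [chord_neg] at this; linarith

lemma chord_sub_two_pi (x : ℝ) : chord (x - 2 * Real.pi) = -chord x := by
  rw [chord, chord, sub_div, mul_div_cancel_left₀ _ (two_ne_zero), Real.sin_sub_pi]; ring

lemma continuous_chord : Continuous chord := by unfold chord; fun_prop

/-- The subtraction formula of the sine; the cosines arise as derivatives of `chord`. -/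
lemma chord_mul_cos_sub (a b : ℝ) :
    chord a * Real.cos (b / 2) - Real.cos (a / 2) * chord b = chord (a - b) := by
  simp only [chord, sub_div, Real.sin_sub]; ring

lemma hasDerivAt_chord (x : ℝ) : HasDerivAt chord (Real.cos (x / 2)) x := by
  have := ((hasDerivAt_id x).div_const 2).sin.const_mul 2
  convert! this using 1
  simp; ring

/-! ### The secular polynomial -/

section Secular

variable {ι : Type*} [Fintype ι] [DecidableEq ι]

/-- The polynomial `∏ (X - a_l) + (1 - t) ∑ q_j a_j ∏_{l ≠ j} (X - a_l)`, whose zeros are the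
moving eigenvalues of `diag(a) (1 + (t - 1) v v†)` when `q_j` is the weight of the unit vector `v`
in the `a_j`-eigenspace. -/
noncomputable def secular (a : ι → ℂ) (t : ℂ) (q : ι → ℝ) : ℂ[X] :=
  ∏ l, (X - C (a l)) + C (1 - t) * ∑ j, C (q j * a j) * ∏ l ∈ Finset.univ.erase j, (X - C (a l))

lemma eval_secular (a : ι → ℂ) (t : ℂ) (q : ι → ℝ) (z : ℂ) :
    (secular a t q).eval z = ∏ l, (z - a l) +
      (1 - t) * ∑ j, (q j * a j) * ∏ l ∈ Finset.univ.erase j, (z - a l) := by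
  simp [secular, eval_prod, eval_finsetSum]

/-- When the weights add up to `1`, every term of the secular polynomial is a product of linear
factors. -/
lemma eval_secular_of_sum_eq_one (a : ι → ℂ) (t : ℂ) (q : ι → ℝ) (hq : ∑ j, q j = 1) (z : ℂ) :
    (secular a t q).eval z =
      ∑ j, q j * ((z - t * a j) * ∏ l ∈ Finset.univ.erase j, (z - a l)) := by
  have hq' : (∑ j, (q j : ℂ)) = 1 := by exact_mod_cast hq
  have h1 : ∏ l, (z - a l) = ∑ j, q j * ∏ l, (z - a l) := by
    rw [← Finset.sum_mul, hq', one_mul]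
  rw [eval_secular, h1, Finset.mul_sum, ← Finset.sum_add_distrib]
  refine Finset.sum_congr rfl fun j _ => ?_
  rw [← Finset.mul_prod_erase Finset.univ _ (Finset.mem_univ j)]
  ring

lemma eval_secular_self (a : ι → ℂ) (t : ℂ) (q : ι → ℝ) (i : ι) :
    (secular a t q).eval (a i) =
      (1 - t) * (q i * a i) * ∏ l ∈ Finset.univ.erase i, (a i - a l) := by
  rw [eval_secular, Finset.prod_eq_zero (Finset.mem_univ i) (sub_self _), zero_add,
    Finset.sum_eq_single i]
  · ring
  · intro j _ hj
    rw [Finset.prod_eq_zero (Finset.mem_erase.2 ⟨hj.symm, Finset.mem_univ i⟩) (sub_self _),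
      mul_zero]
  · simp

lemma degree_prod_X_sub_C {κ : Type*} [Fintype κ] (x : κ → ℂ) :
    (∏ p, (X - C (x p))).degree = (Fintype.card κ : WithBot ℕ) := by
  rw [degree_prod]; simp

lemma degree_C_mul_le_degree (c : ℂ) (p : ℂ[X]) : (C c * p).degree ≤ p.degree := by
  rw [← smul_eq_C_mul]; exact degree_smul_le c p

lemma degree_secular_sub_lt (a : ι → ℂ) (t : ℂ) (q : ι → ℝ) :
    (secular a t q - ∏ l, (X - C (a l))).degree < (Fintype.card ι : WithBot ℕ) := by
  rw [secular, add_sub_cancel_left]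
  refine lt_of_le_of_lt (degree_C_mul_le_degree _ _) ?_
  refine lt_of_le_of_lt (degree_sum_le _ _) ?_
  refine (Finset.sup_lt_iff (WithBot.bot_lt_coe _)).2 fun j _ => ?_
  refine lt_of_le_of_lt (degree_C_mul_le_degree _ _) ?_
  rw [degree_prod]
  simp only [degree_X_sub_C, Finset.sum_const, nsmul_eq_mul, mul_one]
  have : Nonempty ι := ⟨j⟩
  rw [Finset.card_erase_of_mem (Finset.mem_univ _), Finset.card_univ]
  exact_mod_cast Nat.sub_lt Fintype.card_pos one_pos

lemma degree_secular_sub_prod_lt (a x : ι → ℂ) (t : ℂ) (q : ι → ℝ) :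
    (secular a t q - ∏ p, (X - C (x p))).degree < (Fintype.card ι : WithBot ℕ) := by
  by_cases hι : Nonempty ι
  · have h1 : (∏ p, (X - C (a p)) - ∏ p, (X - C (x p))).degree < (Fintype.card ι : WithBot ℕ) := by
      rw [← degree_prod_X_sub_C a]
      apply degree_sub_lt_left
      · rw [degree_prod_X_sub_C, degree_prod_X_sub_C]
      · exact (monic_prod_of_monic _ _ fun i _ => monic_X_sub_C _).ne_zero
      · rw [(monic_prod_of_monic _ _ fun i _ => monic_X_sub_C _).leadingCoeff,
          (monic_prod_of_monic _ _ fun i _ => monic_X_sub_C _).leadingCoeff]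
    rw [← sub_add_sub_cancel _ (∏ p, (X - C (a p))) _]
    exact lt_of_le_of_lt (degree_add_le _ _) (max_lt (degree_secular_sub_lt a t q) h1)
  · rw [not_nonempty_iff] at hι
    simp [secular]

/-- Two monic polynomials of degree `card ι` that agree at `card ι` points are equal. -/
lemma secular_eq_prod_of_eval_eq {a x : ι → ℂ} {t : ℂ} {q : ι → ℝ} {y : ι → ℂ}
    (hy : Function.Injective y)
    (h : ∀ i, (secular a t q).eval (y i) = ∏ p, (y i - x p)) :
    secular a t q = ∏ p, (X - C (x p)) := by
  refine Polynomial.eq_of_degree_sub_lt_of_eval_finset_eq (Finset.univ.image y) ?_ ?_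
  · rw [Finset.card_image_of_injective _ hy, Finset.card_univ]
    exact degree_secular_sub_prod_lt a x t q
  · intro z hz
    obtain ⟨i, -, rfl⟩ := Finset.mem_image.1 hz
    rw [h i]; simp [eval_prod]

/-- Evaluation at `0` turns the factorisation of the secular polynomial into the relation between
the total weight and the product of the roots. -/
lemma prod_roots_eq_of_secular_eq {a x : ι → ℂ} {t : ℂ} {q : ι → ℝ}
    (h : secular a t q = ∏ p, (X - C (x p))) :
    ∏ p, x p = (1 - (1 - t) * ∑ j, (q j : ℂ)) * ∏ l, a l := by
  have h0 := congrArg (Polynomial.eval 0) h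
  rw [eval_secular, eval_prod] at h0
  simp only [zero_sub, eval_sub, eval_X, eval_C] at h0
  have hn : ∀ (s : Finset ι) (f : ι → ℂ), ∏ i ∈ s, -f i = (-1) ^ s.card * ∏ i ∈ s, f i := by
    intro s f; rw [Finset.prod_neg]
  have key : ∀ j, (q j * a j : ℂ) * ∏ l ∈ Finset.univ.erase j, -a l =
      -((-1) ^ (Fintype.card ι) * ∏ l, a l) * q j := by
    intro j
    have h2 : ∏ l, -a l = -a j * ∏ l ∈ Finset.univ.erase j, -a l :=
      (Finset.mul_prod_erase Finset.univ _ (Finset.mem_univ j)).symm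
    rw [hn Finset.univ, Finset.card_univ] at h2
    rw [h2]; ring
  rw [Finset.sum_congr rfl fun j _ => key j, ← Finset.mul_sum, hn, hn, Finset.card_univ] at h0
  have hs : ((-1 : ℂ) ^ Fintype.card ι) ≠ 0 := pow_ne_zero _ (by norm_num)
  refine mul_left_cancel₀ hs ?_
  rw [← h0]; ring

end Secular

/-! ### Interlacing angles and weights -/

section Interlacing

variable {k : ℕ}

lemma Interlaces.strictMono {θ ψ : Fin (k + 1) → ℝ} (h : Interlaces θ ψ) : StrictMono ψ := by
  refine Fin.strictMono_iff_lt_succ.2 fun j => ?_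
  have h1 := (h j.castSucc).2
  have h2 := (h j.succ).1
  simp only [prevAngle, Fin.cons_succ] at h2
  exact h1.trans h2

lemma Interlaces.lt_of_lt {θ ψ : Fin (k + 1) → ℝ} (hθ : StrictMono θ) (h : Interlaces θ ψ)
    {j p : Fin (k + 1)} (hjp : j < p) : θ j < ψ p := by
  obtain ⟨p, rfl⟩ := Fin.exists_succ_eq.2
    (ne_of_gt (lt_of_le_of_lt (Fin.zero_le j) hjp))
  have h2 := (h p.succ).1
  simp only [prevAngle, Fin.cons_succ] at h2
  exact lt_of_le_of_lt (hθ.monotone (Fin.le_castSucc_iff.2 hjp)) h2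

lemma Interlaces.lt_of_le {θ ψ : Fin (k + 1) → ℝ} (hθ : StrictMono θ) (h : Interlaces θ ψ)
    {j p : Fin (k + 1)} (hjp : p ≤ j) : ψ p < θ j :=
  lt_of_lt_of_le (h p).2 (hθ.monotone hjp)

lemma Interlaces.last_sub_lt {θ ψ : Fin (k + 1) → ℝ} (h : Interlaces θ ψ) (p : Fin (k + 1)) :
    θ (Fin.last k) - 2 * Real.pi < ψ p := by
  have h2 := (h 0).1
  simp only [prevAngle, Fin.cons_zero] at h2
  exact lt_of_lt_of_le h2 (h.strictMono.monotone (Fin.zero_le p))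

/-- The angles `θ` increase and fit into a half-open interval of length `2π`, so that the points
`e^{iθ_l}` are distinct and stand in this order on the circle. -/
def Spread (θ : Fin (k + 1) → ℝ) : Prop :=
  StrictMono θ ∧ ∀ i j, θ i - θ j < 2 * Real.pi

lemma Spread.injective_e {θ : Fin (k + 1) → ℝ} (hθ : Spread θ) :
    Function.Injective fun i => e (θ i) := fun i j hij =>
  hθ.1.injective (e_inj_of_abs_sub_lt
    (abs_lt.2 ⟨by have := hθ.2 j i; linarith, hθ.2 i j⟩) hij)

lemma Interlaces.sub_lt {θ ψ : Fin (k + 1) → ℝ} (hθ : Spread θ) (h : Interlaces θ ψ)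
    (j p : Fin (k + 1)) : θ j - ψ p < 2 * Real.pi := by
  have := h.last_sub_lt p
  have := hθ.1.monotone (Fin.le_last j)
  linarith

lemma Interlaces.lt_sub {θ ψ : Fin (k + 1) → ℝ} (hθ : Spread θ) (h : Interlaces θ ψ)
    (j p : Fin (k + 1)) : -(2 * Real.pi) < θ j - ψ p := by
  have := (h p).2
  have := hθ.2 p j
  linarith

lemma Interlaces.e_ne {θ ψ : Fin (k + 1) → ℝ} (hθ : Spread θ) (h : Interlaces θ ψ)
    (j p : Fin (k + 1)) : e (θ j) ≠ e (ψ p) := by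
  intro hjp
  have := e_inj_of_abs_sub_lt (abs_lt.2 ⟨h.lt_sub hθ j p, h.sub_lt hθ j p⟩) hjp
  rcases le_or_gt p j with hp | hp
  · exact (h.lt_of_le hθ.1 hp).ne this.symm
  · exact (h.lt_of_lt hθ.1 hp).ne this

lemma Interlaces.injective_e {θ ψ : Fin (k + 1) → ℝ} (hθ : Spread θ) (h : Interlaces θ ψ) :
    Function.Injective fun i => e (ψ i) := by
  have key : ∀ i j, ψ i - ψ j < 2 * Real.pi := fun i j => by
    have := h.last_sub_lt j
    have := h.lt_of_le hθ.1 (Fin.le_last i)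
    linarith
  intro i j hij
  exact h.strictMono.injective (e_inj_of_abs_sub_lt
    (abs_lt.2 ⟨by have := key j i; linarith, key i j⟩) hij)

/-- An interlacing sequence is determined by the set of points `e^{iψ_p}`. -/
lemma Interlaces.eq_of_e_eq {θ ψ ψ' : Fin (k + 1) → ℝ} (hθ : Spread θ) (h : Interlaces θ ψ)
    (h' : Interlaces θ ψ') {p p' : Fin (k + 1)} (hpp : e (ψ p) = e (ψ' p')) :
    p = p' ∧ ψ p = ψ' p' := by
  have key : ∀ {ψ ψ' : Fin (k + 1) → ℝ}, Interlaces θ ψ → Interlaces θ ψ' → ∀ i j,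
      ψ i - ψ' j < 2 * Real.pi := fun h h' i j => by
    have := h'.last_sub_lt j
    have := h.lt_of_le hθ.1 (Fin.le_last i)
    linarith
  have heq := e_inj_of_abs_sub_lt
    (abs_lt.2 ⟨by have := key h' h p' p; linarith, key h h' p p'⟩) hpp
  refine ⟨?_, heq⟩
  rcases lt_trichotomy p p' with hlt | heq' | hlt
  · have h1 := h.lt_of_le hθ.1 le_rfl (p := p)
    have h2 := h'.lt_of_lt hθ.1 hlt
    linarith
  · exact heq'
  · have h1 := h'.lt_of_le hθ.1 le_rfl (p := p')
    have h2 := h.lt_of_lt hθ.1 hlt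
    linarith

/-- The weight of the perturbing vector in the eigenspace of `e^{iθ_j}`, as a function of the
eigenvalue angles `ψ` of the perturbed matrix: up to phases, the value of `∏ (X - e^{iψ_p})` at
`e^{iθ_j}` divided by `(1 - t) ∏_{l ≠ j} (e^{iθ_j} - e^{iθ_l})`. -/
noncomputable def weight (θ : Fin (k + 1) → ℝ) (φ : ℝ) (ψ : Fin (k + 1) → ℝ) (j : Fin (k + 1)) :
    ℝ :=
  (∏ p, chord (θ j - ψ p)) / (chord φ * ∏ l ∈ Finset.univ.erase j, chord (θ j - θ l))

lemma chord_theta_ne_zero {θ : Fin (k + 1) → ℝ} (hθ : Spread θ) {j l : Fin (k + 1)}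
    (h : l ≠ j) : chord (θ j - θ l) ≠ 0 := by
  have h1 := norm_e_sub_e (θ j) (θ l)
  intro h0
  rw [h0, abs_zero, norm_eq_zero, sub_eq_zero] at h1
  exact h (hθ.injective_e h1).symm

lemma weight_denom_ne_zero {θ : Fin (k + 1) → ℝ} (hθ : Spread θ) {φ : ℝ}
    (hφ : φ ∈ Set.Ioo 0 (2 * Real.pi)) (j : Fin (k + 1)) :
    chord φ * ∏ l ∈ Finset.univ.erase j, chord (θ j - θ l) ≠ 0 :=
  mul_ne_zero (chord_pos hφ.1 hφ.2).ne'
    (Finset.prod_ne_zero_iff.2 fun _ hl => chord_theta_ne_zero hθ (Finset.ne_of_mem_erase hl))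

/-- Interlacing makes each factor of the numerator have the same sign as the factor of the
denominator with the same index; the factor `ψ_j` is compared with `chord φ`. -/
lemma weight_pos {θ ψ : Fin (k + 1) → ℝ} (hθ : Spread θ) {φ : ℝ}
    (hφ : φ ∈ Set.Ioo 0 (2 * Real.pi)) (h : Interlaces θ ψ) (j : Fin (k + 1)) :
    0 < weight θ φ ψ j := by
  rw [weight, ← Finset.mul_prod_erase Finset.univ _ (Finset.mem_univ j), mul_div_mul_comm,
    ← Finset.prod_div_distrib]
  refine mul_pos (div_pos (chord_pos ?_ (h.sub_lt hθ _ _)) (chord_pos hφ.1 hφ.2))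
    (Finset.prod_pos fun l hl => ?_)
  · linarith [h.lt_of_le hθ.1 (le_refl j)]
  rcases lt_or_gt_of_ne (Finset.ne_of_mem_erase hl) with hlj | hlj
  · exact div_pos (chord_pos (by linarith [h.lt_of_le hθ.1 hlj.le]) (h.sub_lt hθ _ _))
      (chord_pos (by linarith [hθ.1 hlj]) (hθ.2 _ _))
  · exact div_pos_of_neg_of_neg
      (chord_neg_of_neg (by linarith [h.lt_of_lt hθ.1 hlj]) (h.lt_sub hθ _ _))
      (chord_neg_of_neg (by linarith [hθ.1 hlj]) (by linarith [hθ.2 l j]))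

lemma one_sub_e (φ : ℝ) : 1 - e φ = -(Complex.I * e (φ / 2) * chord φ) := by
  have := e_sub_e 0 φ
  simp only [e_zero, zero_div, zero_sub, chord_neg] at this
  rw [this]; push_cast; ring

lemma prod_e_sub {ι : Type*} (s : Finset ι) (x : ℝ) (f : ι → ℝ) :
    ∏ i ∈ s, (e x - e (f i)) = (Complex.I * e (x / 2)) ^ s.card * e ((∑ i ∈ s, f i) / 2) *
      ∏ i ∈ s, (chord (x - f i) : ℂ) := by
  rw [Finset.sum_div, e_sum, Finset.prod_congr rfl fun i _ => e_sub_e x (f i),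
    Finset.prod_mul_distrib, Finset.prod_mul_distrib, Finset.prod_const]

lemma prod_e_sub_eq_weight {θ : Fin (k + 1) → ℝ} (hθ : Spread θ) {φ : ℝ}
    (hφ : φ ∈ Set.Ioo 0 (2 * Real.pi)) {ψ : Fin (k + 1) → ℝ}
    (hs : ∑ l, ψ l = φ - 2 * Real.pi + ∑ l, θ l) (j : Fin (k + 1)) :
    ∏ p, (e (θ j) - e (ψ p)) = (1 - e φ) * (weight θ φ ψ j * e (θ j)) *
      ∏ l ∈ Finset.univ.erase j, (e (θ j) - e (θ l)) := by
  have hd := weight_denom_ne_zero hθ hφ j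
  have hw : (∏ p, (chord (θ j - ψ p) : ℂ)) = weight θ φ ψ j *
      (chord φ * ∏ l ∈ Finset.univ.erase j, (chord (θ j - θ l) : ℂ)) := by
    have : ∏ p, chord (θ j - ψ p) = weight θ φ ψ j *
      (chord φ * ∏ l ∈ Finset.univ.erase j, chord (θ j - θ l)) := by
      rw [weight, div_mul_cancel₀ _ hd]
    exact_mod_cast congrArg (fun x : ℝ => (x : ℂ)) this
  -- The phases agree up to the sign `-1 = e^{-iπ}` that the term `-2π` of the sum `∑ ψ_l` gives.
  have h1 : e ((∑ l, ψ l) / 2) =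
      -(e (φ / 2) * e (θ j / 2) * e ((∑ l ∈ Finset.univ.erase j, θ l) / 2)) := by
    rw [hs, ← Finset.add_sum_erase Finset.univ _ (Finset.mem_univ j), ← e_add, ← e_add,
      ← neg_one_mul, ← e_neg_pi, ← e_add]
    congr 1; ring
  rw [prod_e_sub, prod_e_sub, hw, h1, one_sub_e, ← e_half_mul_self (θ j),
    Finset.card_erase_of_mem (Finset.mem_univ j), Finset.card_univ, Fintype.card_fin,
    Nat.add_sub_cancel, pow_succ]
  ring

/-- For interlacing angles on the right hyperplane, the secular polynomial of the weights has the
roots `e^{iψ_p}`. -/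
lemma secular_weight {θ : Fin (k + 1) → ℝ} (hθ : Spread θ) {φ : ℝ}
    (hφ : φ ∈ Set.Ioo 0 (2 * Real.pi)) {ψ : Fin (k + 1) → ℝ}
    (hs : ∑ l, ψ l = φ - 2 * Real.pi + ∑ l, θ l) :
    secular (fun l => e (θ l)) (e φ) (weight θ φ ψ) = ∏ p, (X - C (e (ψ p))) := by
  refine secular_eq_prod_of_eval_eq hθ.injective_e fun i => ?_
  rw [prod_e_sub_eq_weight hθ hφ hs]
  exact eval_secular_self (fun l => e (θ l)) (e φ) (weight θ φ ψ) i

lemma one_sub_e_ne_zero {φ : ℝ} (hφ : φ ∈ Set.Ioo 0 (2 * Real.pi)) : 1 - e φ ≠ 0 := by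
  rw [one_sub_e]
  exact neg_ne_zero.2 (mul_ne_zero (mul_ne_zero Complex.I_ne_zero (e_ne_zero _))
    (Complex.ofReal_ne_zero.2 (chord_pos hφ.1 hφ.2).ne'))

lemma prod_e_ne_zero {ι : Type*} (s : Finset ι) (f : ι → ℝ) : ∏ i ∈ s, e (f i) ≠ 0 :=
  Finset.prod_ne_zero_iff.2 fun _ _ => e_ne_zero _

lemma sum_weight {θ : Fin (k + 1) → ℝ} (hθ : Spread θ) {φ : ℝ}
    (hφ : φ ∈ Set.Ioo 0 (2 * Real.pi)) {ψ : Fin (k + 1) → ℝ}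
    (hs : ∑ l, ψ l = φ - 2 * Real.pi + ∑ l, θ l) :
    ∑ j, weight θ φ ψ j = 1 := by
  have h := prod_roots_eq_of_secular_eq (secular_weight hθ hφ hs)
  have h2 : ∏ p, e (ψ p) = e φ * ∏ l, e (θ l) := by
    rw [← e_sum, ← e_sum, hs, ← e_add]
    refine e_eq_e_iff.2 ⟨-1, ?_⟩
    push_cast; ring
  rw [h2] at h
  have h3 := mul_right_cancel₀ (prod_e_ne_zero _ _) h
  have h4 : (1 - e φ) * (∑ j, (weight θ φ ψ j : ℂ)) = (1 - e φ) * 1 := by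
    linear_combination h3
  have h5 := mul_left_cancel₀ (one_sub_e_ne_zero hφ) h4
  exact_mod_cast h5

/-- The secular polynomial on the unit circle, up to a factor of modulus one. -/
noncomputable def trigSecular (θ : Fin (k + 1) → ℝ) (φ : ℝ) (q : Fin (k + 1) → ℝ) (x : ℝ) : ℝ :=
  ∑ j, q j * (chord (x - (φ + θ j)) * ∏ l ∈ Finset.univ.erase j, chord (x - θ l))

lemma continuous_trigSecular (θ : Fin (k + 1) → ℝ) (φ : ℝ) (q : Fin (k + 1) → ℝ) :
    Continuous (trigSecular θ φ q) := by
  unfold trigSecular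
  have := continuous_chord
  fun_prop

lemma eval_secular_e (θ : Fin (k + 1) → ℝ) (φ : ℝ) {q : Fin (k + 1) → ℝ} (hq : ∑ j, q j = 1)
    (x : ℝ) :
    (secular (fun l => e (θ l)) (e φ) q).eval (e x) =
      (Complex.I * e (x / 2)) ^ (k + 1) * e ((φ + ∑ l, θ l) / 2) * trigSecular θ φ q x := by
  rw [eval_secular_of_sum_eq_one _ _ _ hq, trigSecular]
  push_cast
  rw [Finset.mul_sum]
  refine Finset.sum_congr rfl fun j _ => ?_
  have h1 : e ((φ + ∑ l, θ l) / 2) =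
      e ((φ + θ j) / 2) * e ((∑ l ∈ Finset.univ.erase j, θ l) / 2) := by
    rw [← Finset.add_sum_erase Finset.univ _ (Finset.mem_univ j), ← e_add]
    congr 1; ring
  rw [← e_add, e_sub_e, prod_e_sub, h1, Finset.card_erase_of_mem (Finset.mem_univ j),
    Finset.card_univ, Fintype.card_fin, Nat.add_sub_cancel, pow_succ]
  ring

lemma trigSecular_self (θ : Fin (k + 1) → ℝ) (φ : ℝ) (q : Fin (k + 1) → ℝ) (i : Fin (k + 1)) :
    trigSecular θ φ q (θ i) =
      -(q i * (chord φ * ∏ l ∈ Finset.univ.erase i, chord (θ i - θ l))) := by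
  rw [trigSecular, Finset.sum_eq_single i]
  · rw [show θ i - (φ + θ i) = -φ by ring, chord_neg]; ring
  · intro j _ hj
    rw [Finset.prod_eq_zero (Finset.mem_erase.2 ⟨hj.symm, Finset.mem_univ i⟩)
      (by simp [chord] : chord (θ i - θ i) = 0)]
    ring
  · simp

/-- The gap before the first angle starts at `θ_n - 2π`, where the sign has to be known as well. -/
lemma trigSecular_sub_two_pi (θ : Fin (k + 1) → ℝ) (φ : ℝ) (q : Fin (k + 1) → ℝ) (x : ℝ) :
    trigSecular θ φ q (x - 2 * Real.pi) = (-1) ^ (k + 1) * trigSecular θ φ q x := by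
  rw [trigSecular, trigSecular, Finset.mul_sum]
  refine Finset.sum_congr rfl fun j _ => ?_
  have h : ∀ y, chord (x - 2 * Real.pi - y) = -chord (x - y) := fun y => by
    rw [← chord_sub_two_pi]; congr 1; ring
  simp only [h]
  rw [Finset.prod_neg, Finset.card_erase_of_mem (Finset.mem_univ j), Finset.card_univ,
    Fintype.card_fin, Nat.add_sub_cancel, pow_succ]
  ring

/-- The number of negative factors of `∏_{l ≠ i} chord (θ_i - θ_l)` is the number of angles
beyond `θ_i`. -/
lemma sign_prod_chord {θ : Fin (k + 1) → ℝ} (hθ : Spread θ) (i : Fin (k + 1)) :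
    0 < (-1) ^ (k - i.val) * ∏ l ∈ Finset.univ.erase i, chord (θ i - θ l) := by
  have h1 : (-1 : ℝ) ^ (k - i.val) = ∏ l ∈ Finset.univ.erase i, if i < l then -1 else 1 := by
    rw [Finset.prod_ite, Finset.prod_const, Finset.prod_const_one, mul_one]
    have : (Finset.univ.erase i).filter (fun l => i < l) = Finset.Ioi i := by
      ext l; simp only [Finset.mem_filter, Finset.mem_erase, Finset.mem_univ, Finset.mem_Ioi]
      exact ⟨fun h => h.2, fun h => ⟨⟨h.ne', trivial⟩, h⟩⟩
    rw [this, Fin.card_Ioi]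
    congr 1
  rw [h1, ← Finset.prod_mul_distrib]
  refine Finset.prod_pos fun l hl => ?_
  split_ifs with hil
  · have := chord_neg_of_neg (x := θ i - θ l) (by linarith [hθ.1 hil]) (by linarith [hθ.2 l i])
    linarith
  · have hli : l < i := lt_of_le_of_ne (not_lt.1 hil) (Finset.ne_of_mem_erase hl)
    have := chord_pos (x := θ i - θ l) (by linarith [hθ.1 hli]) (hθ.2 _ _)
    linarith

lemma exists_zero_of_mul_neg {f : ℝ → ℝ} (hf : Continuous f) {a b : ℝ} (hab : a < b)
    (h : f a * f b < 0) : ∃ x, a < x ∧ x < b ∧ f x = 0 := by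
  rcases mul_neg_iff.1 h with ⟨h1, h2⟩ | ⟨h1, h2⟩
  · obtain ⟨x, hx, hx0⟩ := intermediate_value_Ioo' hab.le hf.continuousOn ⟨h2, h1⟩
    exact ⟨x, hx.1, hx.2, hx0⟩
  · obtain ⟨x, hx, hx0⟩ := intermediate_value_Ioo hab.le hf.continuousOn ⟨h1, h2⟩
    exact ⟨x, hx.1, hx.2, hx0⟩

lemma prevAngle_lt {θ : Fin (k + 1) → ℝ} (hθ : Spread θ) (i : Fin (k + 1)) :
    prevAngle θ i < θ i := by
  refine Fin.cases ?_ (fun j => ?_) i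
  · have := hθ.2 (Fin.last k) 0
    simp only [prevAngle, Fin.cons_zero]; linarith
  · simp only [prevAngle, Fin.cons_succ]
    exact hθ.1 (Fin.castSucc_lt_succ)

lemma sign_trigSecular {θ : Fin (k + 1) → ℝ} (hθ : Spread θ) {φ : ℝ}
    (hφ : φ ∈ Set.Ioo 0 (2 * Real.pi)) {q : Fin (k + 1) → ℝ} (hq0 : ∀ j, 0 < q j)
    (i : Fin (k + 1)) : 0 < -((-1) ^ (k - i.val) * trigSecular θ φ q (θ i)) := by
  have := mul_pos (mul_pos (hq0 i) (chord_pos hφ.1 hφ.2)) (sign_prod_chord hθ i)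
  rw [trigSecular_self]
  linarith

lemma trigSecular_mul_neg {θ : Fin (k + 1) → ℝ} (hθ : Spread θ) {φ : ℝ}
    (hφ : φ ∈ Set.Ioo 0 (2 * Real.pi)) {q : Fin (k + 1) → ℝ} (hq0 : ∀ j, 0 < q j)
    (i : Fin (k + 1)) :
    trigSecular θ φ q (prevAngle θ i) * trigSecular θ φ q (θ i) < 0 := by
  refine Fin.cases ?_ (fun j => ?_) i
  · have h1 := sign_trigSecular hθ hφ hq0 0
    have h2 := sign_trigSecular hθ hφ hq0 (Fin.last k)
    simp only [prevAngle, Fin.cons_zero, trigSecular_sub_two_pi, Fin.val_zero, Nat.sub_zero,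
      Fin.val_last, Nat.sub_self, pow_zero, one_mul, pow_succ] at h1 h2 ⊢
    have := mul_pos h1 h2
    linarith
  · have h1 := sign_trigSecular hθ hφ hq0 j.castSucc
    have h2 := sign_trigSecular hθ hφ hq0 j.succ
    simp only [prevAngle, Fin.cons_succ, Fin.val_castSucc, Fin.val_succ] at h1 h2 ⊢
    have hj : k - j.val = (k - (j.val + 1)) + 1 := by have := j.isLt; omega
    rw [hj, pow_succ] at h1
    have h3 := mul_pos h1 h2
    have h4 : ((-1 : ℝ) ^ (k - (j.val + 1))) * (-1) ^ (k - (j.val + 1)) = 1 := by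
      rw [← mul_pow]; simp
    have h5 : 0 < -((((-1 : ℝ) ^ (k - (j.val + 1))) * (-1) ^ (k - (j.val + 1))) *
      (trigSecular θ φ q (θ j.castSucc) * trigSecular θ φ q (θ j.succ))) := by linarith
    rw [h4] at h5
    linarith

lemma sum_prevAngle (θ : Fin (k + 1) → ℝ) : ∑ i, prevAngle θ i = ∑ i, θ i - 2 * Real.pi := by
  rw [prevAngle, Fin.sum_cons, Fin.sum_univ_castSucc θ]; ring

/-- Every point of the open simplex is the weight vector of an interlacing sequence: the secular
polynomial changes sign between two consecutive angles `θ`. -/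
lemma exists_interlaces {θ : Fin (k + 1) → ℝ} (hθ : Spread θ) {φ : ℝ}
    (hφ : φ ∈ Set.Ioo 0 (2 * Real.pi)) {q : Fin (k + 1) → ℝ} (hq0 : ∀ j, 0 < q j)
    (hq : ∑ j, q j = 1) :
    ∃ ψ, Interlaces θ ψ ∧ ∑ l, ψ l = φ - 2 * Real.pi + ∑ l, θ l ∧ weight θ φ ψ = q := by
  choose ψ hψ1 hψ2 hψ0 using fun i => exists_zero_of_mul_neg (continuous_trigSecular θ φ q)
    (prevAngle_lt hθ i) (trigSecular_mul_neg hθ hφ hq0 i)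
  have hI : Interlaces θ ψ := fun i => ⟨hψ1 i, hψ2 i⟩
  have hsec : secular (fun l => e (θ l)) (e φ) q = ∏ p, (X - C (e (ψ p))) := by
    refine secular_eq_prod_of_eval_eq (hI.injective_e hθ) fun i => ?_
    rw [eval_secular_e _ _ hq, hψ0, Finset.prod_eq_zero (Finset.mem_univ i) (sub_self _)]
    simp
  -- The product of the roots gives the sum modulo `2π`, and interlacing confines it to an interval
  -- of length `2π`.
  have hs : ∑ l, ψ l = φ - 2 * Real.pi + ∑ l, θ l := by
    have h := prod_roots_eq_of_secular_eq hsec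
    rw [show ∑ j, (q j : ℂ) = 1 by exact_mod_cast hq, ← e_sum, ← e_sum, mul_one, sub_sub_cancel,
      ← e_add] at h
    have h1 : ∑ l, ψ l < ∑ l, θ l := Finset.sum_lt_sum_of_nonempty ⟨0, Finset.mem_univ _⟩
      fun i _ => hψ2 i
    have h2 : ∑ l, prevAngle θ l < ∑ l, ψ l :=
      Finset.sum_lt_sum_of_nonempty ⟨0, Finset.mem_univ _⟩ fun i _ => hψ1 i
    rw [sum_prevAngle] at h2
    refine e_inj_of_abs_sub_lt (abs_lt.2 ⟨?_, ?_⟩) ?_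
    · linarith [hφ.2]
    · linarith [hφ.1]
    · rw [h]; exact e_eq_e_iff.2 ⟨1, by push_cast; ring⟩
  refine ⟨ψ, hI, hs, funext fun j => ?_⟩
  have h1 := congrArg (Polynomial.eval (e (θ j))) ((secular_weight hθ hφ hs).trans hsec.symm)
  have h2 := eval_secular_self (fun l => e (θ l)) (e φ) (weight θ φ ψ) j
  have h3 := eval_secular_self (fun l => e (θ l)) (e φ) q j
  rw [h2, h3] at h1
  have hne : ∏ l ∈ Finset.univ.erase j, (e (θ j) - e (θ l)) ≠ 0 :=
    Finset.prod_ne_zero_iff.2 fun l hl => sub_ne_zero.2 fun h =>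
      Finset.ne_of_mem_erase hl (hθ.injective_e h).symm
  have h4 := mul_right_cancel₀ (e_ne_zero _) (mul_left_cancel₀ (one_sub_e_ne_zero hφ)
    (mul_right_cancel₀ hne h1))
  exact_mod_cast h4

lemma weight_injective {θ : Fin (k + 1) → ℝ} (hθ : Spread θ) {φ : ℝ}
    (hφ : φ ∈ Set.Ioo 0 (2 * Real.pi)) {ψ ψ' : Fin (k + 1) → ℝ}
    (h : Interlaces θ ψ) (hs : ∑ l, ψ l = φ - 2 * Real.pi + ∑ l, θ l)
    (h' : Interlaces θ ψ') (hs' : ∑ l, ψ' l = φ - 2 * Real.pi + ∑ l, θ l)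
    (hw : weight θ φ ψ = weight θ φ ψ') : ψ = ψ' := by
  have h1 := secular_weight hθ hφ hs
  rw [hw, secular_weight hθ hφ hs'] at h1
  ext p
  have h2 := congrArg (Polynomial.eval (e (ψ p))) h1.symm
  simp only [eval_prod, eval_sub, eval_X, eval_C] at h2
  rw [Finset.prod_eq_zero (Finset.mem_univ p) (sub_self _)] at h2
  obtain ⟨p', -, hp'⟩ := Finset.prod_eq_zero_iff.1 h2.symm
  obtain ⟨rfl, hp⟩ := h.eq_of_e_eq hθ h' (sub_eq_zero.1 hp')
  exact hp

end Interlacing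

/-! ### Products over pairs of indices -/

section PairProducts

variable {M : Type*} [CommMonoid M]

/-- A product over ordered pairs of distinct indices, regrouped over unordered pairs. -/
lemma prod_prod_erase {n : ℕ} (g : Fin n → Fin n → M) :
    ∏ j, ∏ l ∈ Finset.univ.erase j, g j l = ∏ j, ∏ l ∈ Finset.Ioi j, g j l * g l j := by
  have h1 : ∀ j, ∏ l ∈ Finset.univ.erase j, g j l =
      (∏ l ∈ Finset.Ioi j, g j l) * ∏ l ∈ Finset.Iio j, g j l := fun j => by
    rw [← Finset.prod_union]
    · refine Finset.prod_congr ?_ fun _ _ => rfl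
      ext l
      simp only [Finset.mem_erase, Finset.mem_univ, and_true, Finset.mem_union, Finset.mem_Ioi,
        Finset.mem_Iio]
      rw [ne_iff_lt_or_gt, or_comm]
    · rw [Finset.disjoint_left]
      intro l h2 h3
      exact lt_asymm (Finset.mem_Ioi.1 h2) (Finset.mem_Iio.1 h3)
  simp only [h1, Finset.prod_mul_distrib]
  congr 1
  exact Finset.prod_comm' (by simp)

lemma prod_prod_Ioi_castSucc {k : ℕ} (g : Fin (k + 1) → Fin (k + 1) → M) :
    ∏ j, ∏ l ∈ Finset.Ioi j, g j l =
      (∏ j : Fin k, ∏ l ∈ Finset.Ioi j, g j.castSucc l.castSucc) *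
        ∏ j : Fin k, g j.castSucc (Fin.last k) := by
  have h1 : ∀ {n : ℕ} (j : Fin n) (f : Fin n → M),
      ∏ l ∈ Finset.Ioi j, f l = ∏ l, if j < l then f l else 1 := fun j f => by
    rw [← Finset.prod_filter]
    congr 1; ext; simp
  rw [Fin.prod_univ_castSucc, ← Finset.prod_mul_distrib]
  have h2 : ∏ l ∈ Finset.Ioi (Fin.last k), g (Fin.last k) l = 1 :=
    Finset.prod_eq_one fun l hl => absurd (Finset.mem_Ioi.1 hl) (Fin.le_last l).not_gt
  rw [h2, mul_one]
  refine Finset.prod_congr rfl fun j _ => ?_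
  rw [h1, h1, Fin.prod_univ_castSucc]
  simp [Fin.castSucc_lt_last]

lemma prod_erase_castSucc {k : ℕ} (j : Fin k) (f : Fin (k + 1) → M) :
    ∏ l ∈ Finset.univ.erase j.castSucc, f l =
      (∏ l ∈ Finset.univ.erase j, f l.castSucc) * f (Fin.last k) := by
  have h1 : ∀ {n : ℕ} (j : Fin n) (f : Fin n → M),
      ∏ l ∈ Finset.univ.erase j, f l = ∏ l, if l ≠ j then f l else 1 := fun j f => by
    rw [← Finset.prod_filter]
    congr 1; ext; simp
  rw [h1, h1, Fin.prod_univ_castSucc]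
  simp [(Fin.castSucc_lt_last j).ne']

end PairProducts

/-! ### The determinant of the Lagrange matrix -/

/-- The matrix of the values at `a_j` of the polynomials `∏_{p' ≠ p} (X - x_{p'})` is the product
of the Vandermonde matrix of `a` with a matrix of coefficients that does not depend on `a`. Its
determinant is therefore found by comparison with the case `a = x`, where the matrix is
diagonal. -/
lemma norm_det_lagrange {k : ℕ} (a x : Fin k → ℂ) (hx : Function.Injective x) :
    ‖(Matrix.of fun j p => ∏ p' ∈ Finset.univ.erase p, (a j - x p')).det‖ =
      (∏ j, ∏ l ∈ Finset.Ioi j, ‖a l - a j‖) * ∏ j, ∏ l ∈ Finset.Ioi j, ‖x l - x j‖ := by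
  set K : Matrix (Fin k) (Fin k) ℂ :=
    Matrix.of fun i p => (∏ p' ∈ Finset.univ.erase p, (X - C (x p'))).coeff i
  have hK : ∀ b : Fin k → ℂ, (Matrix.of fun j p => ∏ p' ∈ Finset.univ.erase p, (b j - x p')) =
      Matrix.vandermonde b * K := by
    intro b
    ext j p
    have hdeg : (∏ p' ∈ Finset.univ.erase p, (X - C (x p'))).natDegree < k := by
      rw [natDegree_prod_of_monic _ _ fun i _ => monic_X_sub_C _]
      simp only [natDegree_X_sub_C, Finset.sum_const, smul_eq_mul, mul_one]
      rw [Finset.card_erase_of_mem (Finset.mem_univ _), Finset.card_univ, Fintype.card_fin]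
      exact Nat.sub_lt (Fin.pos p) one_pos
    have h1 := eval_eq_sum_range' hdeg (b j)
    rw [eval_prod] at h1
    simp only [eval_sub, eval_X, eval_C] at h1
    rw [Matrix.of_apply, h1, Matrix.mul_apply, Finset.sum_range]
    exact Finset.sum_congr rfl fun i _ => by
      simp only [K, Matrix.vandermonde_apply, Matrix.of_apply]; ring
  have hdiag : (Matrix.of fun j p => ∏ p' ∈ Finset.univ.erase p, (x j - x p')) =
      Matrix.diagonal fun p => ∏ p' ∈ Finset.univ.erase p, (x p - x p') := by
    ext j p
    rw [Matrix.of_apply, Matrix.diagonal_apply]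
    split_ifs with h
    · rw [h]
    · exact Finset.prod_eq_zero (Finset.mem_erase.2 ⟨h, Finset.mem_univ j⟩) (sub_self _)
  have hV : ∀ b : Fin k → ℂ, ‖(Matrix.vandermonde b).det‖ =
      ∏ j, ∏ l ∈ Finset.Ioi j, ‖b l - b j‖ := fun b => by
    rw [Matrix.det_vandermonde, norm_prod]
    exact Finset.prod_congr rfl fun j _ => norm_prod _ _
  have hx' : (∏ j, ∏ l ∈ Finset.Ioi j, ‖x l - x j‖) ≠ 0 := by
    rw [← hV, norm_ne_zero_iff, Matrix.det_vandermonde_ne_zero_iff]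
    exact hx
  have h1 := congrArg (fun A => ‖Matrix.det A‖) (hK a)
  have h2 := congrArg (fun A => ‖Matrix.det A‖) (hK x)
  simp only [Matrix.det_mul, norm_mul, hV] at h1 h2
  rw [hdiag, Matrix.det_diagonal, norm_prod] at h2
  simp only [norm_prod] at h2
  rw [prod_prod_erase fun j l => ‖x j - x l‖] at h2
  have h3 : ∏ j, ∏ l ∈ Finset.Ioi j, ‖x j - x l‖ * ‖x l - x j‖ =
      (∏ j, ∏ l ∈ Finset.Ioi j, ‖x l - x j‖) * ∏ j, ∏ l ∈ Finset.Ioi j, ‖x l - x j‖ := by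
    simp only [← Finset.prod_mul_distrib]
    refine Finset.prod_congr rfl fun j _ => Finset.prod_congr rfl fun l _ => ?_
    rw [norm_sub_rev]
  rw [h1, mul_left_cancel₀ hx' (h3.symm.trans h2)]

/-! ### The Jacobian of the weights -/

section Jacobian

variable {k : ℕ}

/-- The point of the hyperplane `ψ_1 + ⋯ + ψ_{k+1} = s` with given first `k` coordinates. -/
def hyperPoint (s : ℝ) (x : Fin k → ℝ) : Fin (k + 1) → ℝ := Fin.snoc x (s - ∑ j, x j)

lemma sum_hyperPoint (s : ℝ) (x : Fin k → ℝ) : ∑ l, hyperPoint s x l = s := by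
  rw [Fin.sum_univ_castSucc]; simp [hyperPoint]

lemma hyperPoint_castSucc (s : ℝ) (x : Fin k → ℝ) (j : Fin k) :
    hyperPoint s x j.castSucc = x j := by simp [hyperPoint]

lemma hyperPoint_last (s : ℝ) (x : Fin k → ℝ) :
    hyperPoint s x (Fin.last k) = s - ∑ j, x j := by simp [hyperPoint]

lemma hyperPoint_init {s : ℝ} {ψ : Fin (k + 1) → ℝ} (h : ∑ l, ψ l = s) :
    hyperPoint s (fun j => ψ j.castSucc) = ψ := by
  ext i
  refine Fin.lastCases ?_ (fun j => ?_) i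
  · rw [hyperPoint_last, ← h, Fin.sum_univ_castSucc]; ring
  · rw [hyperPoint_castSucc]

lemma continuous_hyperPoint (s : ℝ) : Continuous (hyperPoint (k := k) s) := by
  refine continuous_pi fun i => ?_
  refine Fin.lastCases ?_ (fun j => ?_) i
  · simp only [hyperPoint_last]; fun_prop
  · simp only [hyperPoint_castSucc]; fun_prop

/-- The first `k` weights as functions of the first `k` angles on the hyperplane of sum `s`. -/
noncomputable def weightMap (θ : Fin (k + 1) → ℝ) (φ s : ℝ) (x : Fin k → ℝ) : Fin k → ℝ :=
  fun j => weight θ φ (hyperPoint s x) j.castSucc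

/-- The Jacobian matrix of `weightMap`. The factor `chord (ψ_{k+1} - ψ_p)` comes from the last
angle, which decreases as `ψ_p` increases. -/
noncomputable def jacobian (θ : Fin (k + 1) → ℝ) (φ s : ℝ) (x : Fin k → ℝ) :
    Matrix (Fin k) (Fin k) ℝ :=
  Matrix.of fun j p =>
    (chord φ * ∏ l ∈ Finset.univ.erase j.castSucc, chord (θ j.castSucc - θ l))⁻¹ *
      (chord (hyperPoint s x (Fin.last k) - x p) *
        ∏ p' ∈ Finset.univ.erase p, chord (θ j.castSucc - x p'))

lemma hasFDerivAt_weightMap (θ : Fin (k + 1) → ℝ) (φ s : ℝ) (x : Fin k → ℝ) :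
    HasFDerivAt (weightMap θ φ s) (Matrix.toLin' (jacobian θ φ s x)).toContinuousLinearMap x := by
  rw [hasFDerivAt_pi']
  intro j
  set c := (chord φ * ∏ l ∈ Finset.univ.erase j.castSucc, chord (θ j.castSucc - θ l))⁻¹ with hc
  have h0 : (fun y => weightMap θ φ s y j) = fun y : Fin k → ℝ =>
      c * ((∏ p, chord (θ j.castSucc - y p)) * chord (θ j.castSucc - (s - ∑ p, y p))) := by
    ext y
    rw [weightMap, weight, Fin.prod_univ_castSucc, div_eq_inv_mul]
    simp only [hyperPoint_castSucc, hyperPoint_last, hc]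
  have h1 : ∀ p : Fin k, HasFDerivAt (fun y : Fin k → ℝ => chord (θ j.castSucc - y p))
      (Real.cos ((θ j.castSucc - x p) / 2) •
        (-(ContinuousLinearMap.proj p : (Fin k → ℝ) →L[ℝ] ℝ))) x := fun p =>
    (hasDerivAt_chord _).comp_hasFDerivAt x ((hasFDerivAt_apply p x).const_sub _)
  have h2 : HasFDerivAt (fun y : Fin k → ℝ => chord (θ j.castSucc - (s - ∑ p, y p)))
      (Real.cos ((θ j.castSucc - (s - ∑ p, x p)) / 2) •
        (-(-(∑ p, (ContinuousLinearMap.proj p : (Fin k → ℝ) →L[ℝ] ℝ))))) x :=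
    (hasDerivAt_chord _).comp_hasFDerivAt x
      (((HasFDerivAt.fun_sum fun p _ => hasFDerivAt_apply p x).const_sub _).const_sub _)
  have h3 := ((HasFDerivAt.finsetProd (u := Finset.univ) fun p _ => h1 p).mul h2).const_mul c
  rw [h0]
  convert! h3 using 1
  ext v
  simp only [ContinuousLinearMap.comp_apply, ContinuousLinearMap.proj_apply,
    LinearMap.coe_toContinuousLinearMap', Matrix.toLin'_apply, Matrix.mulVec, dotProduct,
    jacobian, Matrix.of_apply, _root_.smul_apply, _root_.add_apply,
    _root_.sum_apply, _root_.neg_apply, smul_eq_mul, neg_neg,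
    ← hc, hyperPoint_last]
  rw [Finset.mul_sum, Finset.mul_sum, Finset.mul_sum, ← Finset.sum_add_distrib, Finset.mul_sum]
  refine Finset.sum_congr rfl fun p _ => ?_
  have h4 := chord_mul_cos_sub (θ j.castSucc - x p) (θ j.castSucc - (s - ∑ p, x p))
  rw [← Finset.mul_prod_erase Finset.univ _ (Finset.mem_univ p),
    show s - ∑ p, x p - x p = θ j.castSucc - x p - (θ j.castSucc - (s - ∑ p, x p)) by ring, ← h4]
  ring

/-- The Jacobian determinant of the weights is a ratio of Vandermonde products. -/
lemma abs_det_jacobian {θ : Fin (k + 1) → ℝ} (hθ : Spread θ) {φ s : ℝ}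
    {x : Fin k → ℝ} (hx : Interlaces θ (hyperPoint s x)) :
    |(jacobian θ φ s x).det| =
      (∏ j, ∏ l ∈ Finset.Ioi j, ‖e (hyperPoint s x l) - e (hyperPoint s x j)‖) /
        (‖1 - e φ‖ ^ k * ∏ j, ∏ l ∈ Finset.Ioi j, ‖e (θ l) - e (θ j)‖) := by
  have hxinj : Function.Injective fun p => e (x p) := by
    have := (hx.injective_e hθ).comp (Fin.castSucc_injective k)
    simpa only [Function.comp_def, hyperPoint_castSucc] using this
  set A : Matrix (Fin k) (Fin k) ℝ :=
    Matrix.of fun j p => ∏ p' ∈ Finset.univ.erase p, chord (θ j.castSucc - x p') with hA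
  have h1 : |A.det| = (∏ j : Fin k, ∏ l ∈ Finset.Ioi j, ‖e (θ l.castSucc) - e (θ j.castSucc)‖) *
      ∏ j, ∏ l ∈ Finset.Ioi j, ‖e (x l) - e (x j)‖ := by
    rw [← norm_det_lagrange (fun j : Fin k => e (θ j.castSucc)) (fun p => e (x p)) hxinj]
    -- The complex Lagrange matrix differs from `A` by rows and columns of phases.
    have h2 : (Matrix.of fun j p => ∏ p' ∈ Finset.univ.erase p,
        (e (θ (Fin.castSucc j)) - e (x p'))) =
        Matrix.of fun j p => (Complex.I * e (θ j.castSucc / 2)) ^ (k - 1) *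
          (Matrix.of fun j p => e ((∑ i ∈ Finset.univ.erase p, x i) / 2) *
            (A.map Complex.ofRealHom) j p) j p := by
      ext j p
      simp only [Matrix.of_apply, Matrix.map_apply, hA, prod_e_sub]
      rw [Finset.card_erase_of_mem (Finset.mem_univ p), Finset.card_univ, Fintype.card_fin]
      simp [mul_assoc]
    rw [h2, Matrix.det_mul_column, Matrix.det_mul_row, norm_mul, norm_mul, norm_prod, norm_prod,
      ← RingHom.mapMatrix_apply, ← RingHom.map_det]
    simp [norm_e]
  have h3 : jacobian θ φ s x = Matrix.of fun j p =>
      (chord φ * ∏ l ∈ Finset.univ.erase j.castSucc, chord (θ j.castSucc - θ l))⁻¹ *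
        (Matrix.of fun j p => chord (hyperPoint s x (Fin.last k) - x p) * A j p) j p := by
    ext j p
    simp [jacobian, hA]
  have h4 : ‖1 - e φ‖ = |chord φ| := by
    have := norm_e_sub_e 0 φ
    rwa [e_zero, zero_sub, chord_neg, abs_neg] at this
  rw [h3, Matrix.det_mul_column, Matrix.det_mul_row, abs_mul, abs_mul, h1, h4,
    prod_prod_Ioi_castSucc (fun j l => ‖e (hyperPoint s x l) - e (hyperPoint s x j)‖),
    prod_prod_Ioi_castSucc (fun j l => ‖e (θ l) - e (θ j)‖)]
  simp only [hyperPoint_castSucc, Finset.abs_prod, abs_inv, abs_mul, ← norm_e_sub_e]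
  rw [Finset.prod_inv_distrib, Finset.prod_mul_distrib, Finset.prod_const, Finset.card_univ,
    Fintype.card_fin]
  simp only [prod_erase_castSucc, Finset.prod_mul_distrib]
  rw [prod_prod_erase fun j l : Fin k => ‖e (θ j.castSucc) - e (θ l.castSucc)‖]
  simp only [Finset.prod_mul_distrib]
  have h5 : ∏ j : Fin k, ∏ l ∈ Finset.Ioi j, ‖e (θ j.castSucc) - e (θ l.castSucc)‖ =
      ∏ j : Fin k, ∏ l ∈ Finset.Ioi j, ‖e (θ l.castSucc) - e (θ j.castSucc)‖ :=
    Finset.prod_congr rfl fun j _ => Finset.prod_congr rfl fun l _ => norm_sub_rev _ _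
  have h6 : ∏ j : Fin k, ‖e (θ j.castSucc) - e (θ (Fin.last k))‖ =
      ∏ j : Fin k, ‖e (θ (Fin.last k)) - e (θ j.castSucc)‖ :=
    Finset.prod_congr rfl fun j _ => norm_sub_rev _ _
  rw [h5, h6]
  have hne : ∏ j : Fin k, ∏ l ∈ Finset.Ioi j, ‖e (θ l.castSucc) - e (θ j.castSucc)‖ ≠ 0 := by
    refine Finset.prod_ne_zero_iff.2 fun j _ => Finset.prod_ne_zero_iff.2 fun l hl => ?_
    rw [norm_ne_zero_iff, sub_ne_zero]
    exact fun h => (Finset.mem_Ioi.1 hl).ne' (Fin.castSucc_injective k (hθ.injective_e h))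
  field_simp

lemma weight_eq_norm {θ ψ : Fin (k + 1) → ℝ} (hθ : Spread θ) {φ : ℝ}
    (hφ : φ ∈ Set.Ioo 0 (2 * Real.pi)) (h : Interlaces θ ψ) (j : Fin (k + 1)) :
    weight θ φ ψ j = (∏ p, ‖e (θ j) - e (ψ p)‖) /
      (‖1 - e φ‖ * ∏ l ∈ Finset.univ.erase j, ‖e (θ j) - e (θ l)‖) := by
  have h4 : ‖1 - e φ‖ = |chord φ| := by
    have := norm_e_sub_e 0 φ
    rwa [e_zero, zero_sub, chord_neg, abs_neg] at this
  rw [← abs_of_pos (weight_pos hθ hφ h j), weight, abs_div, abs_mul, h4]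
  simp only [Finset.abs_prod, norm_e_sub_e]

/-- The density of the Dirichlet distribution with parameters `m`, as a function of all `k + 1`
weights. -/
noncomputable def dirichletWeight (m : Fin (k + 1) → ℕ) (q : Fin (k + 1) → ℝ) : ℝ :=
  (Real.Gamma ((∑ l, m l : ℕ) : ℝ) / ∏ l, Real.Gamma (m l : ℝ)) * ∏ l, q l ^ (m l - 1)

/-- The density of the statement is the Dirichlet density, transported by the change of
variables. -/
lemma abs_det_mul_dirichletWeight {m : Fin (k + 1) → ℕ} (hm : ∀ l, 1 ≤ m l)
    {θ : Fin (k + 1) → ℝ} (hθ : Spread θ) {φ s : ℝ}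
    (hφ : φ ∈ Set.Ioo 0 (2 * Real.pi)) {x : Fin k → ℝ} (hx : Interlaces θ (hyperPoint s x)) :
    |(jacobian θ φ s x).det| * dirichletWeight m (weight θ φ (hyperPoint s x)) =
      eigenWeight m θ (e φ) (hyperPoint s x) := by
  have hsum : (∑ l, m l) - 1 = k + ∑ l, (m l - 1) := by
    have : ∑ l, m l = ∑ l, ((m l - 1) + 1) :=
      Finset.sum_congr rfl fun l _ => (Nat.sub_add_cancel (hm l)).symm
    rw [this, Finset.sum_add_distrib]
    simp; omega
  have h1 : ∏ l, weight θ φ (hyperPoint s x) l ^ (m l - 1) =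
      (∏ j, ∏ p, ‖e (θ j) - e (hyperPoint s x p)‖ ^ (m j - 1)) /
      (‖1 - e φ‖ ^ (∑ l, (m l - 1)) *
        ∏ j, ∏ l ∈ Finset.Ioi j, ‖e (θ l) - e (θ j)‖ ^ ((m j - 1) + (m l - 1))) := by
    simp only [weight_eq_norm hθ hφ hx, div_pow, mul_pow, Finset.prod_div_distrib,
      Finset.prod_mul_distrib, Finset.prod_pow_eq_pow_sum, ← Finset.prod_pow]
    rw [prod_prod_erase fun j l => ‖e (θ j) - e (θ l)‖ ^ (m j - 1)]
    congr 2
    refine Finset.prod_congr rfl fun j _ => Finset.prod_congr rfl fun l _ => ?_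
    rw [pow_add, norm_sub_rev (e (θ j))]
  have h2 : ∏ j, ∏ l ∈ Finset.Ioi j, ‖e (θ l) - e (θ j)‖ ^ (m j + m l - 1) =
      (∏ j, ∏ l ∈ Finset.Ioi j, ‖e (θ l) - e (θ j)‖) *
        ∏ j, ∏ l ∈ Finset.Ioi j, ‖e (θ l) - e (θ j)‖ ^ ((m j - 1) + (m l - 1)) := by
    simp only [← Finset.prod_mul_distrib]
    refine Finset.prod_congr rfl fun j _ => Finset.prod_congr rfl fun l _ => ?_
    rw [← pow_succ']
    congr 1
    have := hm j; have := hm l; omega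
  rw [abs_det_jacobian hθ hx, dirichletWeight, eigenWeight, h1, h2, hsum, pow_add]
  ring

end Jacobian

/-! ### The characteristic polynomial of the product -/

section Charpoly

variable {N k : ℕ}

/-- The squared norms of the components of `w` in the eigenspaces that `c` describes. -/
noncomputable def blockNorms (c : Fin N → Fin (k + 1)) (w : Fin N → ℂ) (l : Fin (k + 1)) : ℝ :=
  ∑ i with c i = l, ‖w i‖ ^ 2

lemma prod_comp_eq_prod_pow {M : Type*} [CommMonoid M] {m : Fin (k + 1) → ℕ}
    {c : Fin N → Fin (k + 1)} (hc : ∀ l, Fintype.card {i : Fin N // c i = l} = m l)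
    (f : Fin (k + 1) → M) : ∏ i, f (c i) = ∏ l, f l ^ m l := by
  rw [← Finset.prod_fiberwise Finset.univ c]
  refine Finset.prod_congr rfl fun l _ => ?_
  rw [Finset.prod_congr rfl fun i hi => by rw [(Finset.mem_filter.1 hi).2], Finset.prod_const,
    ← hc l, Fintype.card_subtype]

lemma sum_comp_mul_norm_sq (c : Fin N → Fin (k + 1)) (w : Fin N → ℂ) (f : Fin (k + 1) → ℂ) :
    ∑ i, f (c i) * (‖w i‖ ^ 2 : ℝ) = ∑ l, f l * blockNorms c w l := by
  rw [← Finset.sum_fiberwise Finset.univ c]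
  refine Finset.sum_congr rfl fun l _ => ?_
  rw [blockNorms, Complex.ofReal_sum, Finset.mul_sum]
  exact Finset.sum_congr rfl fun i hi => by rw [(Finset.mem_filter.1 hi).2]

/-- The matrix determinant lemma for a rank one perturbation of a diagonal unitary matrix. -/
lemma charpoly_rank_one {m : Fin (k + 1) → ℕ} (hm : ∀ l, 1 ≤ m l)
    {c : Fin N → Fin (k + 1)} (hc : ∀ l, Fintype.card {i : Fin N // c i = l} = m l)
    (a : Fin (k + 1) → ℂ) (t : ℂ) (w : Fin N → ℂ) :
    (Matrix.diagonal (fun i => a (c i)) *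
      (1 + Matrix.of fun i j => (t - 1) * (w i * star (w j)))).charpoly =
      (∏ l, (X - C (a l)) ^ (m l - 1)) * secular a t (blockNorms c w) := by
  refine Polynomial.eq_of_infinite_eval_eq _ _ ?_
  refine Set.Infinite.mono (s := (Set.range a)ᶜ) ?_ (Set.finite_range a).infinite_compl
  -- Away from the points `a_l`, the matrix `z - diag(a)` is invertible and can be factored out.
  intro z hz
  have hza : ∀ l, z - a l ≠ 0 := fun l h => hz ⟨l, (sub_eq_zero.1 h).symm⟩
  change eval z _ = eval z _
  have h1 : Matrix.scalar (Fin N) z - Matrix.diagonal (fun i => a (c i)) *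
      (1 + Matrix.of fun i j => (t - 1) * (w i * star (w j))) =
      Matrix.diagonal (fun i => z - a (c i)) *
        (1 + Matrix.replicateCol Unit (fun i => (1 - t) * (a (c i) / (z - a (c i)) * w i)) *
          Matrix.replicateRow Unit fun j => star (w j)) := by
    ext i j
    rw [Matrix.sub_apply, Matrix.diagonal_mul, Matrix.diagonal_mul]
    simp only [Matrix.add_apply, Matrix.of_apply,
      Matrix.mul_apply, Matrix.replicateCol_apply, Matrix.replicateRow_apply, Matrix.scalar_apply,
      Finset.univ_unique, Finset.sum_singleton, Matrix.diagonal_apply, Matrix.one_apply]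
    have := hza (c i)
    split_ifs
    · field_simp; ring
    · field_simp; ring
  rw [Matrix.eval_charpoly, h1, Matrix.det_mul, Matrix.det_diagonal,
    Matrix.det_one_add_replicateCol_mul_replicateRow, eval_mul, eval_secular,
    prod_comp_eq_prod_pow hc fun l => z - a l]
  have h2 : (fun j => star (w j)) ⬝ᵥ (fun i => (1 - t) * (a (c i) / (z - a (c i)) * w i)) =
      (1 - t) * ∑ l, a l / (z - a l) * blockNorms c w l := by
    rw [← sum_comp_mul_norm_sq c w fun l => a l / (z - a l), dotProduct, Finset.mul_sum]
    refine Finset.sum_congr rfl fun i _ => ?_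
    have : star (w i) * w i = ((‖w i‖ ^ 2 : ℝ) : ℂ) := by
      rw [Complex.star_def, Complex.conj_mul']; push_cast; rfl
    rw [← this]; ring
  have h3 : ∏ l, (z - a l) ^ m l = (∏ l, (z - a l) ^ (m l - 1)) * ∏ l, (z - a l) := by
    rw [← Finset.prod_mul_distrib]
    exact Finset.prod_congr rfl fun l _ => by rw [← pow_succ, Nat.sub_add_cancel (hm l)]
  rw [h2, h3, eval_prod, mul_assoc]
  simp only [eval_pow, eval_sub, eval_X, eval_C]
  congr 1
  rw [mul_add, mul_one, mul_left_comm, Finset.mul_sum]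
  congr 2
  refine Finset.sum_congr rfl fun l _ => ?_
  rw [← Finset.mul_prod_erase Finset.univ _ (Finset.mem_univ l)]
  have := hza l
  field_simp

/-- Conjugation by `U` leaves `A W B W†` with `W = U† V`, and `W B W†` is a rank one perturbation of
the identity along the first column of `W`. -/
lemma charpoly_product {m : Fin (k + 1) → ℕ} (hm : ∀ l, 1 ≤ m l) (θ : Fin (k + 1) → ℝ)
    {c : Fin N → Fin (k + 1)} (hc : ∀ l, Fintype.card {i : Fin N // c i = l} = m l)
    (t : ℂ) (U V : Matrix.unitaryGroup (Fin N) ℂ) {i₀ : Fin N} (hi₀ : i₀.val = 0) :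
    (product (diagA θ c) (diagB N t) U V).charpoly =
      (∏ l, (X - C (e (θ l))) ^ (m l - 1)) * secular (fun l => e (θ l)) t
        (blockNorms c fun i => (U⁻¹ * V : Matrix.unitaryGroup (Fin N) ℂ).1 i i₀) := by
  rw [← charpoly_rank_one hm hc]
  set W : Matrix.unitaryGroup (Fin N) ℂ := U⁻¹ * V with hW
  have hW1 : W.1 = U.1.conjTranspose * V.1 := rfl
  have hW2 : W.1.conjTranspose = V.1.conjTranspose * U.1 := by
    rw [hW1, Matrix.conjTranspose_mul, Matrix.conjTranspose_conjTranspose]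
  have h1 : W.1 * diagB N t * W.1.conjTranspose =
      1 + Matrix.of fun i j => (t - 1) * (W.1 i i₀ * star (W.1 j i₀)) := by
    have hB : diagB N t = 1 + Matrix.diagonal fun i => if i = i₀ then t - 1 else 0 := by
      rw [← Matrix.diagonal_one, Matrix.diagonal_add, diagB]
      congr 1
      ext i
      have : i.val = 0 ↔ i = i₀ := by rw [Fin.ext_iff, hi₀]
      simp only [this]
      split_ifs <;> simp
    have hWW : W.1 * W.1.conjTranspose = 1 := Matrix.mem_unitaryGroup_iff.1 W.2
    rw [hB, mul_add, mul_one, add_mul, hWW]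
    congr 1
    ext i j
    rw [Matrix.mul_apply, Finset.sum_eq_single i₀]
    · rw [Matrix.mul_diagonal, if_pos rfl, Matrix.conjTranspose_apply, Matrix.of_apply]
      ring
    · intro l _ hl
      rw [Matrix.mul_diagonal, if_neg hl]; simp
    · simp
  rw [← h1, hW2, hW1, product]
  simp only [mul_assoc]
  rw [Matrix.charpoly_mul_comm]
  simp only [mul_assoc]
  rfl

lemma sum_blockNorms (c : Fin N → Fin (k + 1)) (w : Fin N → ℂ) :
    ∑ l, blockNorms c w l = ∑ i, ‖w i‖ ^ 2 :=
  Finset.sum_fiberwise Finset.univ c _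

end Charpoly

/-! ### Haar measure on the unitary group and the uniform distribution on the ball -/

section Haar

variable {N : ℕ}

instance : LocallyCompactSpace (Matrix.unitaryGroup (Fin N) ℂ) :=
  haveI : LocallyCompactSpace (Matrix (Fin N) (Fin N) ℂ) :=
    inferInstanceAs (LocallyCompactSpace (Fin N → Fin N → ℂ))
  isClosed_unitary.isClosedEmbedding_subtypeVal.locallyCompactSpace

/-- Haar probability measures are right invariant: a right translate is again a left-invariant
probability measure. -/
lemma isMulRightInvariant_of_isProbabilityMeasure {G : Type*} [Group G] [TopologicalSpace G]
    [IsTopologicalGroup G] [LocallyCompactSpace G] [MeasurableSpace G] [BorelSpace G]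
    (μ : Measure G) [μ.IsHaarMeasure] [IsProbabilityMeasure μ] : μ.IsMulRightInvariant := by
  have hcompact : CompactSpace G := by
    by_contra H
    rw [not_compactSpace_iff] at H
    simpa using measure_univ_of_isMulLeftInvariant μ
  refine ⟨fun g => ?_⟩
  have hg : Measurable fun x : G => x * g := (continuous_mul_const g).measurable
  have h1 : (μ.map (· * g)).IsMulLeftInvariant := by
    refine ⟨fun h => ?_⟩
    have hh : Measurable fun x : G => h * x := (continuous_const_mul h).measurable
    rw [Measure.map_map hh hg]
    conv_rhs => rw [← map_mul_left_eq_self μ h]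
    rw [Measure.map_map hg hh]
    congr 1
    ext x
    simp [mul_assoc]
  have h2 : IsProbabilityMeasure (μ.map (· * g)) := Measure.isProbabilityMeasure_map hg.aemeasurable
  have h3 := Measure.isMulInvariant_eq_smul_of_compactSpace (μ.map (· * g)) μ
  have h4 := congrArg (fun ν : Measure G => ν Set.univ) h3
  simp only [measure_univ, Measure.smul_apply] at h4
  rw [h3]
  have h5 : Measure.haarScalarFactor (μ.map (· * g)) μ = 1 := by
    rw [ENNReal.smul_def, smul_eq_mul, mul_one] at h4
    exact_mod_cast h4.symm
  rw [h5, one_smul]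

lemma measurable_entry [MeasurableSpace (Matrix.unitaryGroup (Fin N) ℂ)]
    [BorelSpace (Matrix.unitaryGroup (Fin N) ℂ)] (i j : Fin N) :
    Measurable fun U : Matrix.unitaryGroup (Fin N) ℂ => U.1 i j :=
  (continuous_subtype_val.matrix_elem i j).measurable

/-- The open unit ball of `ℂ^N` for the Euclidean norm, which is not the norm of `Fin N → ℂ`. -/
def unitBall (N : ℕ) : Set (Fin N → ℂ) := {z | ∑ i, ‖z i‖ ^ 2 < 1}

lemma isOpen_unitBall : IsOpen (unitBall N) :=
  isOpen_lt (by fun_prop) continuous_const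

lemma volume_unitBall_ne_zero : volume (unitBall N) ≠ 0 :=
  (isOpen_unitBall.measure_pos _ ⟨0, by simp [unitBall]⟩).ne'

lemma volume_unitBall_ne_top : volume (unitBall N) ≠ ⊤ := by
  refine ne_top_of_le_ne_top (b := volume (Metric.closedBall (0 : Fin N → ℂ) 1))
    (isCompact_closedBall _ _).measure_lt_top.ne (measure_mono fun z hz => ?_)
  rw [mem_closedBall_zero_iff, pi_norm_le_iff_of_nonneg zero_le_one]
  intro i
  have h1 : ‖z i‖ ^ 2 ≤ ∑ i, ‖z i‖ ^ 2 :=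
    Finset.single_le_sum (f := fun i => ‖z i‖ ^ 2) (fun _ _ => by positivity) (Finset.mem_univ i)
  have h2 : ‖z i‖ ^ 2 ≤ 1 := h1.trans hz.le
  exact (sq_le_one_iff₀ (norm_nonneg _)).1 h2

lemma sum_norm_sq_eq (z : Fin N → ℂ) : ((∑ i, ‖z i‖ ^ 2 : ℝ) : ℂ) = star z ⬝ᵥ z := by
  rw [dotProduct, Complex.ofReal_sum]
  refine Finset.sum_congr rfl fun i _ => ?_
  rw [Pi.star_apply, Complex.star_def, Complex.conj_mul']; push_cast; rfl

lemma sum_norm_sq_mulVec (W : Matrix.unitaryGroup (Fin N) ℂ) (z : Fin N → ℂ) :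
    ∑ i, ‖(W.1.mulVec z) i‖ ^ 2 = ∑ i, ‖z i‖ ^ 2 := by
  rw [← Complex.ofReal_inj, sum_norm_sq_eq, sum_norm_sq_eq, Matrix.star_mulVec,
    ← Matrix.dotProduct_mulVec, Matrix.mulVec_mulVec]
  have : W.1.conjTranspose * W.1 = 1 := Matrix.mem_unitaryGroup_iff'.1 W.2
  rw [this, Matrix.one_mulVec]

/-- A unitary matrix preserves Lebesgue measure: it multiplies it by a constant, and it preserves
the unit ball. -/
lemma measurePreserving_mulVec (W : Matrix.unitaryGroup (Fin N) ℂ) :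
    MeasurePreserving (fun z : Fin N → ℂ => W.1.mulVec z) volume volume := by
  have hcont : ∀ W : Matrix (Fin N) (Fin N) ℂ, Continuous fun z : Fin N → ℂ => W.mulVec z :=
    fun W => continuous_const.matrix_mulVec continuous_id
  set f : (Fin N → ℂ) →ₗ[ℝ] (Fin N → ℂ) := (Matrix.mulVecLin W.1).restrictScalars ℝ with hf
  set g : (Fin N → ℂ) →ₗ[ℝ] (Fin N → ℂ) := (Matrix.mulVecLin (W⁻¹).1).restrictScalars ℝ with hg
  have hfg : f ∘ₗ g = LinearMap.id := by
    refine LinearMap.ext fun z => ?_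
    change W.1.mulVec ((W⁻¹).1.mulVec z) = z
    rw [Matrix.mulVec_mulVec]
    have : W.1 * (W⁻¹).1 = 1 := congrArg Subtype.val (mul_inv_cancel W)
    rw [this, Matrix.one_mulVec]
  have hdet : LinearMap.det f ≠ 0 := by
    intro h
    have := congrArg LinearMap.det hfg
    rw [LinearMap.det_comp, h, zero_mul, LinearMap.det_id] at this
    exact zero_ne_one this
  have h1 := Measure.map_linearMap_addHaar_eq_smul_addHaar (volume : Measure (Fin N → ℂ)) hdet
  have h2 : (f ⁻¹' unitBall N) = unitBall N := by
    ext z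
    change ∑ i, ‖(W.1.mulVec z) i‖ ^ 2 < 1 ↔ ∑ i, ‖z i‖ ^ 2 < 1
    rw [sum_norm_sq_mulVec]
  refine ⟨(hcont _).measurable, ?_⟩
  have h3 := congrArg (fun ν : Measure (Fin N → ℂ) => ν (unitBall N)) h1
  simp only [Measure.smul_apply, smul_eq_mul] at h3
  rw [Measure.map_apply (show Measurable f from (hcont W.1).measurable)
    isOpen_unitBall.measurableSet, h2] at h3
  have h4 : ENNReal.ofReal |(LinearMap.det f)⁻¹| = 1 := by
    refine (ENNReal.mul_left_inj (volume_unitBall_ne_zero (N := N)) volume_unitBall_ne_top).1 ?_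
    rw [← h3, one_mul]
  rw [h4, one_smul] at h1
  exact h1

/-- Every nonzero vector is a positive multiple of a column of a unitary matrix. -/
lemma exists_unitary_column (i₀ : Fin N) {z : Fin N → ℂ} (hz : z ≠ 0) :
    ∃ (R : Matrix.unitaryGroup (Fin N) ℂ) (r : ℝ), 0 < r ∧ z = fun i => r • R.1 i i₀ := by
  set y : EuclideanSpace ℂ (Fin N) := WithLp.toLp 2 z with hy
  have hy0 : ‖y‖ ≠ 0 := norm_ne_zero_iff.2 fun h => hz (by simpa [hy] using h)
  set v : Fin N → EuclideanSpace ℂ (Fin N) := fun _ => ((‖y‖⁻¹ : ℝ) : ℂ) • y with hv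
  have hnv : ‖((‖y‖⁻¹ : ℝ) : ℂ) • y‖ = 1 := by
    rw [norm_smul, Complex.norm_real, norm_inv, norm_norm, inv_mul_cancel₀ hy0]
  have horth : Orthonormal ℂ (({i₀} : Set (Fin N)).domRestrict v) := by
    refine ⟨fun i => hnv, fun i j hij => ?_⟩
    exact absurd (Subsingleton.elim i j) hij
  obtain ⟨b, hb⟩ := horth.exists_orthonormalBasis_extension_of_card_eq (by simp)
  have hb0 := hb i₀ rfl
  refine ⟨⟨Matrix.of fun i j => b j i, ?_⟩, ‖y‖, lt_of_le_of_ne (norm_nonneg _) hy0.symm, ?_⟩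
  · rw [Matrix.mem_unitaryGroup_iff']
    ext i j
    rw [Matrix.mul_apply, Matrix.one_apply]
    have := orthonormal_iff_ite.1 b.orthonormal i j
    rw [← this, PiLp.inner_apply]
    refine Finset.sum_congr rfl fun l _ => ?_
    rw [Matrix.star_apply, Matrix.of_apply, Matrix.of_apply, RCLike.inner_apply, mul_comm]
    rfl
  · ext i
    have h1 : b i₀ i = ((‖y‖⁻¹ : ℝ) : ℂ) * z i := by rw [hb0]; rfl
    simp only [Matrix.of_apply, h1, Complex.real_smul]
    rw [← mul_assoc, ← Complex.ofReal_mul, mul_inv_cancel₀ hy0]; simp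

variable [MeasurableSpace (Matrix.unitaryGroup (Fin N) ℂ)]
  [BorelSpace (Matrix.unitaryGroup (Fin N) ℂ)]

/-- A column of a Haar distributed unitary matrix is uniformly distributed on the sphere. The
sphere is replaced by the unit ball, and functions on the sphere by positively homogeneous functions
of degree `0`: averaging such a function over the ball and over all unitary matrices, in either
order, gives the two sides. -/
lemma lintegral_column_mul_volume (haar : Measure (Matrix.unitaryGroup (Fin N) ℂ))
    [haar.IsHaarMeasure] [IsProbabilityMeasure haar] (i₀ : Fin N) {f : (Fin N → ℂ) → ENNReal}
    (hf : Measurable f) (hhom : ∀ (r : ℝ) (z : Fin N → ℂ), 0 < r → f (r • z) = f z) :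
    (∫⁻ U, f (fun i => U.1 i i₀) ∂haar) * volume (unitBall N) = ∫⁻ z in unitBall N, f z := by
  have hright := isMulRightInvariant_of_isProbabilityMeasure haar
  have hN : Nonempty (Fin N) := ⟨i₀⟩
  have hmeas : Measurable fun p : Matrix.unitaryGroup (Fin N) ℂ × (Fin N → ℂ) =>
      f (p.1.1.mulVec p.2) := by
    refine hf.comp (measurable_pi_iff.2 fun i => ?_)
    simp only [Matrix.mulVec, dotProduct]
    exact Finset.measurable_sum _ fun j _ => ((measurable_entry i j).comp measurable_fst).mul
      ((measurable_pi_apply j).comp measurable_snd)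
  have h1 : ∀ W : Matrix.unitaryGroup (Fin N) ℂ,
      ∫⁻ z in unitBall N, f (W.1.mulVec z) = ∫⁻ z in unitBall N, f z := by
    intro W
    have h2 : (fun z : Fin N → ℂ => W.1.mulVec z) ⁻¹' unitBall N = unitBall N := by
      ext z
      change ∑ i, ‖(W.1.mulVec z) i‖ ^ 2 < 1 ↔ ∑ i, ‖z i‖ ^ 2 < 1
      rw [sum_norm_sq_mulVec]
    have := (measurePreserving_mulVec W).setLIntegral_comp_preimage
      (isOpen_unitBall (N := N)).measurableSet hf
    rwa [h2] at this
  have h3 : ∀ z : Fin N → ℂ, z ≠ 0 →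
      ∫⁻ W, f (W.1.mulVec z) ∂haar = ∫⁻ U, f (fun i => U.1 i i₀) ∂haar := by
    intro z hz
    obtain ⟨R, r, hr, rfl⟩ := exists_unitary_column i₀ hz
    rw [← lintegral_mul_right_eq_self (fun U => f (fun i => U.1 i i₀)) R]
    refine lintegral_congr fun W => ?_
    rw [← hhom r (fun i => (W * R).1 i i₀) hr]
    congr 1
    ext i
    simp only [Matrix.mulVec, dotProduct, Pi.smul_apply]
    change _ = r • (W.1 * R.1) i i₀
    rw [Matrix.mul_apply, Finset.smul_sum]
    exact Finset.sum_congr rfl fun j _ => by rw [mul_smul_comm]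
  calc (∫⁻ U, f (fun i => U.1 i i₀) ∂haar) * volume (unitBall N)
      = ∫⁻ _z in unitBall N, (∫⁻ U, f (fun i => U.1 i i₀) ∂haar) := by
        rw [setLIntegral_const]
    _ = ∫⁻ z in unitBall N, ∫⁻ W, f (W.1.mulVec z) ∂haar := by
        refine lintegral_congr_ae (ae_restrict_of_ae ?_)
        have h0 : ∀ᵐ z : Fin N → ℂ, z ≠ 0 := by
          rw [ae_iff]; simp
        filter_upwards [h0] with z hz
        rw [h3 z hz]
    _ = ∫⁻ W, (∫⁻ z in unitBall N, f (W.1.mulVec z)) ∂haar :=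
        lintegral_lintegral_swap (hmeas.comp measurable_swap).aemeasurable
    _ = ∫⁻ z in unitBall N, f z := by
        simp only [h1, lintegral_const, measure_univ, mul_one]

/-- For independent Haar distributed `U` and `V`, a column of `U⁻¹ V` is distributed like a column
of a Haar distributed matrix. -/
lemma lintegral_column_inv_mul {haar : Measure (Matrix.unitaryGroup (Fin N) ℂ)}
    [haar.IsHaarMeasure] [IsProbabilityMeasure haar]
    {Ω : Type*} [MeasurableSpace Ω] {P : Measure Ω} [IsProbabilityMeasure P]
    {U V : Ω → Matrix.unitaryGroup (Fin N) ℂ} (hU : Measurable U) (hV : Measurable V)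
    (hU_law : P.map U = haar) (hV_law : P.map V = haar) (hUV : IndepFun U V P) (i₀ : Fin N)
    {f : (Fin N → ℂ) → ENNReal} (hf : Measurable f) :
    ∫⁻ ω, f (fun i => ((U ω)⁻¹ * V ω).1 i i₀) ∂P = ∫⁻ W, f (fun i => W.1 i i₀) ∂haar := by
  have hprod : P.map (fun ω => (U ω, V ω)) = haar.prod haar := by
    rw [(indepFun_iff_map_prod_eq_prod_map_map hU.aemeasurable hV.aemeasurable).1 hUV, hU_law,
      hV_law]
  have hmeas : Measurable fun p : Matrix.unitaryGroup (Fin N) ℂ × Matrix.unitaryGroup (Fin N) ℂ =>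
      f (fun i => (p.1⁻¹ * p.2).1 i i₀) := by
    refine hf.comp (measurable_pi_iff.2 fun i => ?_)
    have : (fun p : Matrix.unitaryGroup (Fin N) ℂ × Matrix.unitaryGroup (Fin N) ℂ =>
        (p.1⁻¹ * p.2).1 i i₀) = fun p => ∑ j, star (p.1.1 j i) * p.2.1 j i₀ := by
      ext p
      change (p.1.1.conjTranspose * p.2.1) i i₀ = _
      rw [Matrix.mul_apply]
      rfl
    rw [this]
    exact Finset.measurable_sum _ fun j _ =>
      (continuous_star.measurable.comp ((measurable_entry j i).comp measurable_fst)).mul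
        ((measurable_entry j i₀).comp measurable_snd)
  rw [← lintegral_map (f := fun p : Matrix.unitaryGroup (Fin N) ℂ ×
    Matrix.unitaryGroup (Fin N) ℂ => f (fun i => (p.1⁻¹ * p.2).1 i i₀)) hmeas (hU.prodMk hV), hprod,
    lintegral_prod _ hmeas.aemeasurable]
  simp only [lintegral_mul_left_eq_self (fun W : Matrix.unitaryGroup (Fin N) ℂ =>
    f (fun i => W.1 i i₀)), lintegral_const, measure_univ, mul_one]

end Haar

/-! ### The law of the squared norm of a complex vector -/

/-- The density of the image of Lebesgue measure on `ℂ^m` under `z ↦ ‖z‖²`. -/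
noncomputable def radialDensity (m : ℕ) (s : ℝ) : ENNReal :=
  if 0 < s then ENNReal.ofReal (Real.pi ^ m / Real.Gamma m * s ^ (m - 1)) else 0

lemma measurable_radialDensity (m : ℕ) : Measurable (radialDensity m) :=
  Measurable.ite measurableSet_Ioi (by fun_prop) measurable_const

lemma radialDensity_mul {m : ℕ} {r : ℝ} (hr : 0 < r) (s : ℝ) :
    radialDensity m (r * s) = ENNReal.ofReal (r ^ (m - 1)) * radialDensity m s := by
  unfold radialDensity
  by_cases hs : 0 < s
  · rw [if_pos (mul_pos hr hs), if_pos hs, ← ENNReal.ofReal_mul (by positivity), mul_pow]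
    congr 1; ring
  · rw [if_neg hs, if_neg (by rwa [mul_pos_iff_of_pos_left hr]), mul_zero]

lemma lintegral_radialDensity_Iio {m : ℕ} (hm : 1 ≤ m) {r : ℝ} (hr : 0 < r) :
    ∫⁻ s in Set.Iio r, radialDensity m s =
      ENNReal.ofReal (Real.pi ^ m / Real.Gamma (m + 1) * r ^ m) := by
  have hm0 : (m : ℝ) ≠ 0 := by positivity
  have hΓ : 0 < Real.Gamma m := Real.Gamma_pos_of_pos (by positivity)
  have h1 : radialDensity m =
      (Set.Ioi (0 : ℝ)).indicator fun s =>
        ENNReal.ofReal (Real.pi ^ m / Real.Gamma m * s ^ (m - 1)) := by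
    ext s; simp [radialDensity, Set.indicator]
  rw [h1, lintegral_indicator measurableSet_Ioi, Measure.restrict_restrict measurableSet_Ioi,
    Set.Ioi_inter_Iio, Measure.restrict_congr_set (Ioo_ae_eq_Ioc (a := (0 : ℝ)) (b := r)),
    ← ofReal_integral_eq_lintegral_ofReal]
  · rw [← intervalIntegral.integral_of_le hr.le, intervalIntegral.integral_const_mul, integral_pow,
      Real.Gamma_add_one hm0, Nat.sub_add_cancel hm, zero_pow (by omega)]
    push_cast [Nat.cast_sub hm]
    congr 1
    field_simp
    ring_nf
    field_simp
  · exact (Continuous.integrableOn_Icc (by fun_prop)).mono_set Set.Ioc_subset_Icc_self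
  · filter_upwards [ae_restrict_mem measurableSet_Ioc] with s hs
    have := hs.1
    positivity

/-- Comparison of distribution functions: the volume of balls in `ℂ^ι` is known. -/
lemma map_sum_norm_sq {ι : Type*} [Fintype ι] [Nonempty ι] :
    (volume : Measure (ι → ℂ)).map (fun z => ∑ i, ‖z i‖ ^ 2) =
      volume.withDensity (radialDensity (Fintype.card ι)) := by
  have hmeas : Measurable fun z : ι → ℂ => ∑ i, ‖z i‖ ^ 2 := by fun_prop
  have hIio : ∀ r : ℝ, (volume : Measure (ι → ℂ)).map (fun z => ∑ i, ‖z i‖ ^ 2) (Set.Iio r) =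
      if 0 < r then ENNReal.ofReal (Real.pi ^ Fintype.card ι / Real.Gamma (Fintype.card ι + 1) *
        r ^ Fintype.card ι) else 0 := by
    intro r
    rw [Measure.map_apply hmeas measurableSet_Iio]
    split_ifs with hr
    · have h1 := Complex.volume_sum_rpow_lt (ι := ι) one_le_two (Real.sqrt r)
      have h2 : (fun z : ι → ℂ => ∑ i, ‖z i‖ ^ 2) ⁻¹' Set.Iio r =
          {x : ι → ℂ | (∑ i, ‖x i‖ ^ (2 : ℝ)) ^ (1 / (2 : ℝ)) < Real.sqrt r} := by
        ext z
        simp only [Set.mem_preimage, Set.mem_Iio, Set.mem_ofPred_eq, Real.rpow_two]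
        rw [← Real.sqrt_eq_rpow, Real.sqrt_lt_sqrt_iff (by positivity)]
      rw [h2, h1, ← ENNReal.ofReal_pow (Real.sqrt_nonneg r), ← ENNReal.ofReal_mul (by positivity),
        pow_mul, Real.sq_sqrt hr.le]
      congr 1
      have h3 : Real.Gamma (2 / 2 + 1) = 1 := by norm_num
      rw [h3, mul_div_cancel_left₀ _ (two_ne_zero), mul_one]
      ring
    · have : (fun z : ι → ℂ => ∑ i, ‖z i‖ ^ 2) ⁻¹' Set.Iio r = ∅ := by
        ext z
        simp only [Set.mem_preimage, Set.mem_Iio, Set.mem_empty_iff_false, iff_false, not_lt]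
        exact (not_lt.1 hr).trans (by positivity)
      rw [this, measure_empty]
  refine Measure.ext_of_generateFrom_of_iUnion (Set.range Set.Iio) (fun n : ℕ => Set.Iio (n : ℝ))
    ((BorelSpace.measurable_eq).trans (borel_eq_generateFrom_Iio ℝ)) isPiSystem_Iio ?_ ?_ ?_ ?_
  · exact Set.eq_univ_of_forall fun x => Set.mem_iUnion.2 (exists_nat_gt x)
  · exact fun n => ⟨n, rfl⟩
  · intro n
    rw [hIio]
    split_ifs
    · exact ENNReal.ofReal_ne_top
    · exact ENNReal.zero_ne_top
  · rintro _ ⟨r, rfl⟩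
    rw [hIio, withDensity_apply _ measurableSet_Iio]
    split_ifs with hr
    · rw [lintegral_radialDensity_Iio Fintype.card_pos hr]
    · rw [setLIntegral_congr_fun (f := radialDensity (Fintype.card ι)) (g := fun _ => 0)
        measurableSet_Iio
        fun s hs => if_neg (not_lt.2 ((le_of_lt hs).trans (not_lt.1 hr)))]
      simp

/-! ### Lebesgue measure and blocks of coordinates -/

lemma lintegral_snoc {k : ℕ} {f : (Fin (k + 1) → ℝ) → ENNReal} (hf : Measurable f) :
    ∫⁻ s, f s = ∫⁻ x : Fin k → ℝ, ∫⁻ y : ℝ, f (Fin.snoc x y : Fin (k + 1) → ℝ) := by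
  have h := (volume_preserving_piFinSuccAbove (fun _ : Fin (k + 1) => ℝ) (Fin.last k)).symm
  rw [← h.lintegral_comp hf, Measure.volume_eq_prod,
    lintegral_prod_symm' (fun a => f ((MeasurableEquiv.piFinSuccAbove (fun _ => ℝ)
      (Fin.last k)).symm a)) (hf.comp h.measurable)]
  refine lintegral_congr fun x => lintegral_congr fun y => ?_
  congr 1
  exact Fin.insertNth_last' y x

lemma lintegral_prod_coordinates {n : ℕ} {f : Fin n → ℝ → ENNReal} (hf : ∀ i, Measurable (f i)) :
    ∫⁻ x : Fin n → ℝ, ∏ i, f i (x i) = ∏ i, ∫⁻ y, f i y := by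
  induction n with
  | zero => simp [volume_pi]
  | succ n ih =>
    have hm : Measurable fun x : Fin (n + 1) → ℝ => ∏ i, f i (x i) :=
      Finset.measurable_prod _ fun i _ => (hf i).comp (measurable_pi_apply i)
    rw [lintegral_snoc hm, Fin.prod_univ_castSucc, ← ih fun i => hf i.castSucc,
      ← lintegral_mul_const _ (Finset.measurable_prod _ fun i _ =>
        (hf i.castSucc).comp (measurable_pi_apply i))]
    refine lintegral_congr fun x => ?_
    simp only [Fin.prod_univ_castSucc, Fin.snoc_castSucc, Fin.snoc_last]
    rw [lintegral_const_mul _ (hf _)]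

/-- Grouping the coordinates of `ℂ^N` into blocks identifies Lebesgue measure with a product of
Lebesgue measures. -/
lemma map_blocks_volume {N : ℕ} {κ : Type*} [Fintype κ] [DecidableEq κ] (c : Fin N → κ) :
    (volume : Measure (Fin N → ℂ)).map (fun z l (i : {i // c i = l}) => z i) =
      Measure.pi fun l => (volume : Measure ({i // c i = l} → ℂ)) := by
  have hmeas : Measurable fun (z : Fin N → ℂ) l (i : {i // c i = l}) => z i := by fun_prop
  symm
  refine Measure.pi_eq_generateFrom
    (C := fun l => Set.pi Set.univ '' Set.pi Set.univ fun _ : {i // c i = l} =>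
      {s : Set ℂ | MeasurableSet s})
    (fun l => generateFrom_pi) (fun l => isPiSystem_pi)
    (fun l => Measure.FiniteSpanningSetsIn.pi fun _ => Measure.toFiniteSpanningSetsIn _) ?_
  intro s hs
  choose t ht hst using hs
  obtain rfl : (fun l => Set.pi Set.univ (t l)) = s := funext hst
  have hpre : (fun (z : Fin N → ℂ) l (i : {i // c i = l}) => z i) ⁻¹'
      (Set.univ.pi fun l => Set.univ.pi (t l)) = Set.univ.pi fun i => t (c i) ⟨i, rfl⟩ := by
    ext z
    simp only [Set.mem_preimage, Set.mem_univ_pi]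
    exact ⟨fun h i => h _ _, fun h l i => by obtain ⟨i, rfl⟩ := i; exact h i⟩
  rw [Measure.map_apply hmeas (MeasurableSet.univ_pi fun l => MeasurableSet.univ_pi fun i =>
    ht l i (Set.mem_univ _)), hpre, volume_pi_pi, ← Fintype.prod_fiberwise c]
  refine Finset.prod_congr rfl fun l _ => ?_
  rw [Measure.pi_pi]
  refine Finset.prod_congr rfl fun i _ => ?_
  obtain ⟨i, rfl⟩ := i
  rfl

lemma measurable_blockNorms {N k : ℕ} (c : Fin N → Fin (k + 1)) :
    Measurable (blockNorms c) := by
  unfold blockNorms; fun_prop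

/-- The squared norms of the blocks of a vector in `ℂ^N` have a joint density with respect to
Lebesgue measure which is a product. -/
lemma map_blockNorms {N k : ℕ} {m : Fin (k + 1) → ℕ} (hm : ∀ l, 1 ≤ m l)
    {c : Fin N → Fin (k + 1)} (hc : ∀ l, Fintype.card {i : Fin N // c i = l} = m l) :
    (volume : Measure (Fin N → ℂ)).map (blockNorms c) =
      volume.withDensity fun s => ∏ l, radialDensity (m l) (s l) := by
  have hne : ∀ l, Nonempty {i // c i = l} := fun l =>
    Fintype.card_pos_iff.1 (by rw [hc l]; exact hm l)
  have hg : Measurable fun (y : (l : Fin (k + 1)) → {i // c i = l} → ℂ) l => ∑ i, ‖y l i‖ ^ 2 := by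
    fun_prop
  have h1 : blockNorms c = (fun (y : (l : Fin (k + 1)) → {i // c i = l} → ℂ) l =>
      ∑ i, ‖y l i‖ ^ 2) ∘ fun (z : Fin N → ℂ) l (i : {i // c i = l}) => z i := by
    ext z l
    exact (Finset.sum_subtype _ (by simp) fun i => ‖z i‖ ^ 2)
  have h2 : ∀ l, IsFiniteMeasureOnCompacts (volume.withDensity (radialDensity (m l))) := by
    intro l
    refine ⟨fun K hK => ?_⟩
    obtain ⟨r, hr⟩ := hK.bddAbove
    have hK' : K ⊆ Set.Iio (max r 0 + 1) := fun x hx =>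
      lt_of_le_of_lt ((hr hx).trans (le_max_left r 0)) (lt_add_one _)
    refine lt_of_le_of_lt (measure_mono hK') ?_
    rw [withDensity_apply _ measurableSet_Iio, lintegral_radialDensity_Iio (hm l) (by positivity)]
    exact ENNReal.ofReal_lt_top
  have h3 : Measure.pi (fun l => volume.withDensity (radialDensity (m l))) =
      volume.map (blockNorms c) := by
    refine Measure.pi_eq fun s hs => ?_
    rw [h1, ← Measure.map_map hg (by fun_prop), map_blocks_volume,
      Measure.map_apply hg (MeasurableSet.univ_pi hs)]
    have h4 : (fun (y : (l : Fin (k + 1)) → {i // c i = l} → ℂ) l => ∑ i, ‖y l i‖ ^ 2) ⁻¹'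
        Set.univ.pi s = Set.univ.pi fun l =>
          (fun y : {i // c i = l} → ℂ => ∑ i, ‖y i‖ ^ 2) ⁻¹' s l := by
      ext y; simp
    rw [h4, Measure.pi_pi]
    refine Finset.prod_congr rfl fun l _ => ?_
    rw [← Measure.map_apply (by fun_prop) (hs l), map_sum_norm_sq, hc l]
  rw [← h3]
  refine Measure.pi_eq fun s hs => ?_
  have hind : (Set.univ.pi s).indicator (fun x : Fin (k + 1) → ℝ =>
      ∏ l, radialDensity (m l) (x l)) =
      fun x => ∏ l, (s l).indicator (radialDensity (m l)) (x l) := by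
    ext x
    by_cases hx : x ∈ Set.univ.pi s
    · rw [Set.indicator_of_mem hx]
      exact Finset.prod_congr rfl fun l _ => (Set.indicator_of_mem (hx l (Set.mem_univ l)) _).symm
    · rw [Set.indicator_of_notMem hx]
      simp only [Set.mem_univ_pi, not_forall] at hx
      obtain ⟨l, hl⟩ := hx
      exact (Finset.prod_eq_zero (Finset.mem_univ l) (Set.indicator_of_notMem hl _)).symm
  rw [withDensity_apply _ (MeasurableSet.univ_pi hs), ← lintegral_indicator
    (MeasurableSet.univ_pi hs), hind, lintegral_prod_coordinates fun l =>
    (measurable_radialDensity _).indicator (hs l)]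
  refine Finset.prod_congr rfl fun l _ => ?_
  rw [lintegral_indicator (hs l), withDensity_apply _ (hs l)]

/-! ### The Dirichlet law of the weights -/

section Dirichlet

variable {N k : ℕ}

lemma lintegral_comp_smul_pi {r : ℝ} (hr : 0 < r) {g : (Fin k → ℝ) → ENNReal}
    (hg : Measurable g) :
    ∫⁻ x, g x = ENNReal.ofReal (r ^ k) * ∫⁻ x, g (r • x) := by
  rw [← lintegral_map hg (measurable_const_smul r), Measure.map_addHaar_smul _ hr.ne',
    lintegral_smul_measure, smul_eq_mul, ← mul_assoc, ← ENNReal.ofReal_mul (by positivity),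
    Module.finrank_fintype_fun_eq_card, Fintype.card_fin, abs_of_pos (by positivity),
    mul_inv_cancel₀ (by positivity), ENNReal.ofReal_one, one_mul]

/-- The unnormalised Dirichlet density, as a function of the first `k` weights. -/
noncomputable def simplexDensity (m : Fin (k + 1) → ℕ) (q : Fin k → ℝ) : ENNReal :=
  ∏ l, radialDensity (m l) (hyperPoint 1 q l)

lemma measurable_prod_radialDensity (m : Fin (k + 1) → ℕ) :
    Measurable fun s : Fin (k + 1) → ℝ => ∏ l, radialDensity (m l) (s l) :=
  Finset.measurable_prod _ fun l _ => (measurable_radialDensity (m l)).comp (measurable_pi_apply l)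

lemma measurable_simplexDensity (m : Fin (k + 1) → ℕ) : Measurable (simplexDensity m) :=
  (measurable_prod_radialDensity m).comp (continuous_hyperPoint 1).measurable

lemma prod_radialDensity_hyperPoint_smul (m : Fin (k + 1) → ℕ) {r : ℝ} (hr : 0 < r)
    (q : Fin k → ℝ) :
    ∏ l, radialDensity (m l) (hyperPoint r (r • q) l) =
      ENNReal.ofReal (r ^ ∑ l, (m l - 1)) * simplexDensity m q := by
  have h1 : hyperPoint r (r • q) = r • hyperPoint 1 q := by
    ext i
    refine Fin.lastCases ?_ (fun j => ?_) i
    · simp only [hyperPoint_last, Pi.smul_apply, smul_eq_mul, ← Finset.mul_sum]; ring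
    · simp only [hyperPoint_castSucc, Pi.smul_apply]
  rw [h1, simplexDensity, ← Finset.prod_pow_eq_pow_sum,
    ENNReal.ofReal_prod_of_nonneg fun _ _ => by positivity, ← Finset.prod_mul_distrib]
  exact Finset.prod_congr rfl fun l _ => radialDensity_mul hr _

/-- The first `k` coordinates of a vector, divided by the sum of all coordinates. -/
noncomputable def proportions (s : Fin (k + 1) → ℝ) : Fin k → ℝ :=
  fun j => s j.castSucc / ∑ l, s l

lemma measurable_proportions : Measurable (proportions (k := k)) := by
  unfold proportions; fun_prop

lemma lintegral_unit_interval_pow (n : ℕ) :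
    ∫⁻ r in Set.Ioo (0 : ℝ) 1, ENNReal.ofReal (r ^ n) = ENNReal.ofReal (1 / (n + 1)) := by
  rw [Measure.restrict_congr_set (Ioo_ae_eq_Ioc (a := (0 : ℝ)) (b := 1)),
    ← ofReal_integral_eq_lintegral_ofReal]
  · rw [← intervalIntegral.integral_of_le zero_le_one, integral_pow]; simp
  · exact (Continuous.integrableOn_Icc (by fun_prop)).mono_set Set.Ioc_subset_Icc_self
  · filter_upwards [ae_restrict_mem measurableSet_Ioc] with s hs
    have := hs.1
    positivity

/-- Integration in the coordinates `s = r (q, 1 - ∑ q)`, where `r` is the sum of the coordinates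
of `s`. -/
lemma lintegral_proportions {m : Fin (k + 1) → ℕ} {F : (Fin k → ℝ) → ENNReal} (hF : Measurable F) :
    ∫⁻ s : Fin (k + 1) → ℝ, ((Set.Iio 1).indicator 1 (∑ l, s l) * F (proportions s)) *
        ∏ l, radialDensity (m l) (s l) =
      ENNReal.ofReal (1 / ((k + ∑ l, (m l - 1) : ℕ) + 1)) * ∫⁻ q, F q * simplexDensity m q := by
  have hm1 : Measurable ((Set.Iio (1 : ℝ)).indicator (1 : ℝ → ENNReal)) :=
    measurable_one.indicator measurableSet_Iio
  set Φ : (Fin (k + 1) → ℝ) → ENNReal := fun s =>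
    ((Set.Iio 1).indicator 1 (∑ l, s l) * F (proportions s)) * ∏ l, radialDensity (m l) (s l)
    with hΦ
  have hmeas : Measurable Φ :=
    ((hm1.comp (by fun_prop)).mul (hF.comp measurable_proportions)).mul
      (measurable_prod_radialDensity m)
  have hH : Measurable fun p : (Fin k → ℝ) × ℝ => hyperPoint p.2 p.1 := by
    refine measurable_pi_iff.2 fun i => ?_
    refine Fin.lastCases ?_ (fun j => ?_) i
    · simp only [hyperPoint_last]; fun_prop
    · simp only [hyperPoint_castSucc]; fun_prop
  rw [lintegral_snoc hmeas]
  -- Translating the last coordinate makes the sum `r` of all coordinates the second variable.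
  have h1 : ∀ x : Fin k → ℝ, (∫⁻ y : ℝ, Φ (Fin.snoc x y : Fin (k + 1) → ℝ)) =
      ∫⁻ r : ℝ, Φ (hyperPoint r x) := fun x =>
    (lintegral_sub_right_eq_self (fun y : ℝ => Φ (Fin.snoc x y : Fin (k + 1) → ℝ)) (∑ j, x j)).symm
  rw [lintegral_congr h1, lintegral_lintegral_swap
    (f := fun (x : Fin k → ℝ) r => Φ (hyperPoint r x)) (hmeas.comp hH).aemeasurable]
  have h2 : ∀ r : ℝ, (∫⁻ x : Fin k → ℝ, Φ (hyperPoint r x)) =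
      (Set.Ioo (0 : ℝ) 1).indicator (fun r =>
        ENNReal.ofReal (r ^ (k + ∑ l, (m l - 1))) * ∫⁻ q, F q * simplexDensity m q) r := by
    intro r
    simp only [hΦ, sum_hyperPoint]
    by_cases hr1 : r < 1
    · by_cases hr : 0 < r
      · rw [Set.indicator_of_mem (s := Set.Ioo (0 : ℝ) 1) ⟨hr, hr1⟩, lintegral_comp_smul_pi hr,
          pow_add, ENNReal.ofReal_mul (by positivity), mul_assoc]
        · congr 1
          rw [← lintegral_const_mul _ (show Measurable fun q => F q * simplexDensity m q from
            hF.mul (measurable_simplexDensity m))]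
          refine lintegral_congr fun q => ?_
          have h3 : proportions (hyperPoint r (r • q)) = q := by
            ext j
            rw [proportions, sum_hyperPoint, hyperPoint_castSucc, Pi.smul_apply, smul_eq_mul,
              mul_div_cancel_left₀ _ hr.ne']
          rw [Set.indicator_of_mem (s := Set.Iio (1 : ℝ)) hr1, Pi.one_apply, one_mul, h3,
            prod_radialDensity_hyperPoint_smul m hr, mul_left_comm]
        · have := hmeas.comp (continuous_hyperPoint (k := k) r).measurable
          simpa only [hΦ, Function.comp_def, sum_hyperPoint] using this
      · -- Coordinates with a sum that is not positive cannot all be positive.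
        rw [Set.indicator_of_notMem (s := Set.Ioo (0 : ℝ) 1) fun h => hr h.1]
        have h3 : ∀ x : Fin k → ℝ, ∏ l, radialDensity (m l) (hyperPoint r x l) = 0 := by
          intro x
          obtain ⟨l, hl⟩ : ∃ l, hyperPoint r x l ≤ 0 := by
            by_contra! h
            have := Finset.sum_pos (fun l _ => h l) (Finset.univ_nonempty)
            rw [sum_hyperPoint] at this
            exact hr this
          exact Finset.prod_eq_zero (Finset.mem_univ l) (if_neg (not_lt.2 hl))
        simp [h3]
    · rw [Set.indicator_of_notMem (s := Set.Ioo (0 : ℝ) 1) fun h => hr1 h.2]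
      simp [Set.indicator_of_notMem (s := Set.Iio (1 : ℝ)) (a := r) hr1]
  rw [lintegral_congr h2, lintegral_indicator measurableSet_Ioo,
    lintegral_mul_const _ (by fun_prop), lintegral_unit_interval_pow]

lemma volume_unitBall (hN : 0 < N) :
    volume (unitBall N) = ENNReal.ofReal (Real.pi ^ N / Real.Gamma (N + 1)) := by
  have : Nonempty (Fin N) := ⟨⟨0, hN⟩⟩
  have h1 := lintegral_radialDensity_Iio (m := N) hN one_pos
  rw [one_pow, mul_one] at h1
  rw [← h1, ← withDensity_apply _ measurableSet_Iio]
  have h2 := map_sum_norm_sq (ι := Fin N)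
  rw [Fintype.card_fin] at h2
  rw [← h2, Measure.map_apply (by fun_prop) measurableSet_Iio]
  rfl

/-- The open simplex in the coordinates of the first `k` weights. -/
def openSimplex (k : ℕ) : Set (Fin k → ℝ) := {q | ∀ l, 0 < hyperPoint 1 q l}

lemma measurableSet_openSimplex : MeasurableSet (openSimplex k) := by
  have : openSimplex k = ⋂ l, (fun q => hyperPoint 1 q l) ⁻¹' Set.Ioi 0 := by
    ext q; simp [openSimplex]
  rw [this]
  exact MeasurableSet.iInter fun l =>
    ((measurable_pi_apply l).comp (continuous_hyperPoint 1).measurable) measurableSet_Ioi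

lemma simplexDensity_eq {m : Fin (k + 1) → ℕ} (hm : ∀ l, 1 ≤ m l) (hN : ∑ l, m l = N)
    (q : Fin k → ℝ) :
    ENNReal.ofReal (1 / ((k + ∑ l, (m l - 1) : ℕ) + 1)) * simplexDensity m q =
      (openSimplex k).indicator (fun q => ENNReal.ofReal (dirichletWeight m (hyperPoint 1 q))) q *
        ENNReal.ofReal (Real.pi ^ N / Real.Gamma (N + 1)) := by
  have hsum : k + ∑ l, (m l - 1) + 1 = N := by
    have : ∑ l, m l = ∑ l, ((m l - 1) + 1) :=
      Finset.sum_congr rfl fun l _ => (Nat.sub_add_cancel (hm l)).symm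
    rw [← hN, this, Finset.sum_add_distrib]
    simp; omega
  have hN0 : 0 < N := by omega
  have hN' : ((k + ∑ l, (m l - 1) : ℕ) : ℝ) + 1 = N := by exact_mod_cast hsum
  by_cases hq : q ∈ openSimplex k
  · have hpos : ∀ l, 0 < Real.Gamma (m l) := fun l =>
      Real.Gamma_pos_of_pos (by have := hm l; positivity)
    have hΓ : 0 < Real.Gamma N := Real.Gamma_pos_of_pos (by positivity)
    have hN1 : (N : ℝ) ≠ 0 := by positivity
    have h1 : simplexDensity m q = ENNReal.ofReal
        (∏ l, (Real.pi ^ m l / Real.Gamma (m l) * hyperPoint 1 q l ^ (m l - 1))) := by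
      rw [simplexDensity, ENNReal.ofReal_prod_of_nonneg fun l _ => by
        have := hpos l; have := hq l; positivity]
      exact Finset.prod_congr rfl fun l _ => if_pos (hq l)
    rw [Set.indicator_of_mem hq, h1, ← ENNReal.ofReal_mul (by positivity),
      ← ENNReal.ofReal_mul, hN']
    · congr 1
      have h2 : ∏ l, Real.pi ^ m l = Real.pi ^ N := by
        rw [Finset.prod_pow_eq_pow_sum, hN]
      rw [Finset.prod_mul_distrib, Finset.prod_div_distrib, h2, dirichletWeight, hN,
        Real.Gamma_add_one hN1]
      have : ∏ l, Real.Gamma (m l) ≠ 0 := Finset.prod_ne_zero_iff.2 fun l _ => (hpos l).ne'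
      field_simp
    · refine mul_nonneg (div_nonneg ?_ (Finset.prod_nonneg fun l _ => (hpos l).le))
        (Finset.prod_nonneg fun l _ => pow_nonneg (hq l).le _)
      rw [hN]; exact hΓ.le
  · rw [Set.indicator_of_notMem hq, zero_mul]
    simp only [openSimplex, Set.mem_ofPred_eq, not_forall] at hq
    obtain ⟨l, hl⟩ := hq
    rw [simplexDensity, Finset.prod_eq_zero (Finset.mem_univ l) (if_neg hl), mul_zero]

/-- The eigenspace weights of a column of a Haar distributed unitary matrix follow the Dirichlet
distribution with the multiplicities as parameters. -/
lemma lintegral_weights_column {m : Fin (k + 1) → ℕ} (hm : ∀ l, 1 ≤ m l)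
    {c : Fin N → Fin (k + 1)} (hc : ∀ l, Fintype.card {i : Fin N // c i = l} = m l)
    [MeasurableSpace (Matrix.unitaryGroup (Fin N) ℂ)]
    [BorelSpace (Matrix.unitaryGroup (Fin N) ℂ)]
    (haar : Measure (Matrix.unitaryGroup (Fin N) ℂ)) [haar.IsHaarMeasure]
    [IsProbabilityMeasure haar] (i₀ : Fin N) {F : (Fin k → ℝ) → ENNReal} (hF : Measurable F) :
    ∫⁻ W, F (proportions (blockNorms c fun i => W.1 i i₀)) ∂haar =
      ∫⁻ q in openSimplex k, F q * ENNReal.ofReal (dirichletWeight m (hyperPoint 1 q)) := by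
  have hN : ∑ l, m l = N := by
    have := Finset.sum_fiberwise Finset.univ c fun _ => 1
    simp only [Finset.sum_const, smul_eq_mul, mul_one, Finset.card_univ, Fintype.card_fin] at this
    rw [← this]
    exact Finset.sum_congr rfl fun l _ => by rw [← hc l, Fintype.card_subtype]
  have hN0 : 0 < N := i₀.pos
  have hf : Measurable fun z : Fin N → ℂ => F (proportions (blockNorms c z)) :=
    hF.comp (measurable_proportions.comp (measurable_blockNorms c))
  have hhom : ∀ (r : ℝ) (z : Fin N → ℂ), 0 < r →
      F (proportions (blockNorms c (r • z))) = F (proportions (blockNorms c z)) := by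
    intro r z hr
    have h1 : blockNorms c (r • z) = r ^ 2 • blockNorms c z := by
      ext l
      simp only [blockNorms, Pi.smul_apply, norm_smul, mul_pow, smul_eq_mul, Finset.mul_sum,
        Real.norm_eq_abs, sq_abs]
    rw [h1]
    congr 1
    ext j
    simp only [proportions, Pi.smul_apply, smul_eq_mul, ← Finset.mul_sum]
    rw [mul_div_mul_left _ _ (by positivity)]
  have key := lintegral_column_mul_volume haar i₀ hf hhom
  have hm1 : Measurable ((Set.Iio (1 : ℝ)).indicator (1 : ℝ → ENNReal)) :=
    measurable_one.indicator measurableSet_Iio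
  have hG : Measurable fun s : Fin (k + 1) → ℝ =>
      (Set.Iio 1).indicator 1 (∑ l, s l) * F (proportions s) :=
    (hm1.comp (by fun_prop)).mul (hF.comp measurable_proportions)
  have hFs : Measurable fun q => F q * simplexDensity m q := hF.mul (measurable_simplexDensity m)
  have h2 : ∫⁻ z in unitBall N, F (proportions (blockNorms c z)) =
      ∫⁻ z : Fin N → ℂ, (Set.Iio 1).indicator 1 (∑ l, blockNorms c z l) *
        F (proportions (blockNorms c z)) := by
    rw [← lintegral_indicator isOpen_unitBall.measurableSet]
    refine lintegral_congr fun z => ?_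
    rw [sum_blockNorms]
    by_cases hz : z ∈ unitBall N
    · rw [Set.indicator_of_mem hz, Set.indicator_of_mem (s := Set.Iio (1 : ℝ)) hz, Pi.one_apply,
        one_mul]
    · rw [Set.indicator_of_notMem hz, Set.indicator_of_notMem (s := Set.Iio (1 : ℝ)) hz, zero_mul]
  rw [h2, ← lintegral_map (f := fun s : Fin (k + 1) → ℝ =>
      (Set.Iio 1).indicator 1 (∑ l, s l) * F (proportions s)) hG (measurable_blockNorms c),
    map_blockNorms hm hc, lintegral_withDensity_eq_lintegral_mul _
      (measurable_prod_radialDensity m) hG] at key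
  simp only [Pi.mul_apply, mul_comm (∏ l, radialDensity _ _)] at key
  rw [lintegral_proportions hF, ← lintegral_const_mul _ hFs,
    volume_unitBall hN0] at key
  simp only [mul_left_comm _ (F _), simplexDensity_eq hm hN] at key
  simp only [← mul_assoc] at key
  rw [lintegral_mul_const'] at key
  · rw [← lintegral_indicator measurableSet_openSimplex]
    have hv : ENNReal.ofReal (Real.pi ^ N / Real.Gamma (N + 1)) ≠ 0 := by
      rw [← volume_unitBall hN0]; exact volume_unitBall_ne_zero
    rw [(ENNReal.mul_left_inj hv ENNReal.ofReal_ne_top).1 key]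
    refine lintegral_congr fun q => ?_
    by_cases hq : q ∈ openSimplex k
    · rw [Set.indicator_of_mem hq, Set.indicator_of_mem hq]
    · rw [Set.indicator_of_notMem hq, Set.indicator_of_notMem hq, mul_zero]
  · exact ENNReal.ofReal_ne_top

end Dirichlet

/-! ### Change of variables from weights to angles -/

section ChangeOfVariables

variable {k : ℕ}

/-- The interlacing region in the coordinates of the first `k` angles, on the hyperplane of
sum `s`. -/
def interlacingRegion (θ : Fin (k + 1) → ℝ) (s : ℝ) : Set (Fin k → ℝ) :=
  {x | Interlaces θ (hyperPoint s x)}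

lemma measurableSet_interlaces (θ : Fin (k + 1) → ℝ) : MeasurableSet {ψ | Interlaces θ ψ} := by
  have : {ψ | Interlaces θ ψ} = ⋂ i, (fun ψ : Fin (k + 1) → ℝ => ψ i) ⁻¹'
      Set.Ioo (prevAngle θ i) (θ i) := by
    ext ψ; simp [Interlaces]
  rw [this]
  exact MeasurableSet.iInter fun i => measurable_pi_apply i measurableSet_Ioo

lemma measurableSet_interlacingRegion (θ : Fin (k + 1) → ℝ) (s : ℝ) :
    MeasurableSet (interlacingRegion θ s) :=
  (continuous_hyperPoint s).measurable (measurableSet_interlaces θ)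

lemma measurable_eigenDensity (m : Fin (k + 1) → ℕ) (θ : Fin (k + 1) → ℝ) (t : ℂ) :
    Measurable (eigenDensity m θ t) := by
  have he : Continuous e := by unfold e; fun_prop
  have hw : Continuous (eigenWeight m θ t) := by unfold eigenWeight; fun_prop
  unfold eigenDensity
  exact Measurable.ite (measurableSet_interlaces θ) hw.measurable.ennreal_ofReal measurable_const

variable {θ : Fin (k + 1) → ℝ} {φ s : ℝ}

lemma hyperPoint_weightMap (hθ : Spread θ) (hφ : φ ∈ Set.Ioo 0 (2 * Real.pi))
    (hs : s = φ - 2 * Real.pi + ∑ l, θ l) (x : Fin k → ℝ) :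
    hyperPoint 1 (weightMap θ φ s x) = weight θ φ (hyperPoint s x) :=
  hyperPoint_init (sum_weight hθ hφ (by rw [sum_hyperPoint, hs]))

lemma injOn_weightMap (hθ : Spread θ) (hφ : φ ∈ Set.Ioo 0 (2 * Real.pi))
    (hs : s = φ - 2 * Real.pi + ∑ l, θ l) :
    Set.InjOn (weightMap θ φ s) (interlacingRegion θ s) := by
  intro x hx y hy hxy
  have h1 := congrArg (hyperPoint 1) hxy
  rw [hyperPoint_weightMap hθ hφ hs, hyperPoint_weightMap hθ hφ hs] at h1
  have h2 := weight_injective hθ hφ hx (by rw [sum_hyperPoint, hs]) hy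
    (by rw [sum_hyperPoint, hs]) h1
  ext j
  simpa only [hyperPoint_castSucc] using congrFun h2 j.castSucc

lemma image_weightMap (hθ : Spread θ) (hφ : φ ∈ Set.Ioo 0 (2 * Real.pi))
    (hs : s = φ - 2 * Real.pi + ∑ l, θ l) :
    weightMap θ φ s '' interlacingRegion θ s = openSimplex k := by
  ext q
  constructor
  · rintro ⟨x, hx, rfl⟩ l
    rw [hyperPoint_weightMap hθ hφ hs]
    exact weight_pos hθ hφ hx l
  · intro hq
    obtain ⟨ψ, hI, hψs, hw⟩ := exists_interlaces hθ hφ hq (sum_hyperPoint 1 q)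
    have h1 : hyperPoint s (fun j => ψ j.castSucc) = ψ := hyperPoint_init (by rw [hψs, hs])
    refine ⟨fun j => ψ j.castSucc, ?_, ?_⟩
    · change Interlaces θ (hyperPoint s fun j => ψ j.castSucc)
      rwa [h1]
    · ext j
      rw [weightMap, h1, hw, hyperPoint_castSucc]

/-- The angles as a measurable function of the weights: an injective differentiable map on a
measurable set is a measurable embedding. -/
lemma exists_measurable_leftInverse (hθ : Spread θ) (hφ : φ ∈ Set.Ioo 0 (2 * Real.pi))
    (hs : s = φ - 2 * Real.pi + ∑ l, θ l) :
    ∃ G : (Fin k → ℝ) → Fin k → ℝ, Measurable G ∧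
      ∀ x ∈ interlacingRegion θ s, G (weightMap θ φ s x) = x := by
  have hemb := measurableEmbedding_of_fderivWithin (measurableSet_interlacingRegion θ s)
    (fun x _ => (hasFDerivAt_weightMap θ φ s x).hasFDerivWithinAt) (injOn_weightMap hθ hφ hs)
  obtain ⟨G, hG, hG'⟩ := hemb.exists_measurable_extend measurable_subtype_coe fun _ => ⟨0⟩
  exact ⟨G, hG, fun x hx => congrFun hG' ⟨x, hx⟩⟩

/-- The Dirichlet law of the weights, transported to the angles. -/
lemma setLIntegral_openSimplex {m : Fin (k + 1) → ℕ} (hm : ∀ l, 1 ≤ m l)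
    (hθ : Spread θ) (hφ : φ ∈ Set.Ioo 0 (2 * Real.pi))
    (hs : s = φ - 2 * Real.pi + ∑ l, θ l) (F : (Fin k → ℝ) → ENNReal) :
    ∫⁻ q in openSimplex k, F q * ENNReal.ofReal (dirichletWeight m (hyperPoint 1 q)) =
      ∫⁻ x, F (weightMap θ φ s x) * eigenDensity m θ (e φ) (hyperPoint s x) := by
  rw [← image_weightMap hθ hφ hs, lintegral_image_eq_lintegral_abs_det_fderiv_mul _
    (measurableSet_interlacingRegion θ s)
    (fun x _ => (hasFDerivAt_weightMap θ φ s x).hasFDerivWithinAt) (injOn_weightMap hθ hφ hs),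
    ← lintegral_indicator (measurableSet_interlacingRegion θ s)]
  refine lintegral_congr fun x => ?_
  by_cases hx : x ∈ interlacingRegion θ s
  · rw [Set.indicator_of_mem hx, eigenDensity, if_pos (show Interlaces θ _ from hx),
      hyperPoint_weightMap hθ hφ hs,
      ← abs_det_mul_dirichletWeight hm hθ hφ hx, ENNReal.ofReal_mul (abs_nonneg _),
      LinearMap.det_toContinuousLinearMap, LinearMap.det_toLin', mul_left_comm]
  · rw [Set.indicator_of_notMem hx, eigenDensity, if_neg (show ¬ Interlaces θ _ from hx), mul_zero]

end ChangeOfVariables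

end MultHorn

open MultHorn

theorem proposition2 {N k : ℕ} (m : Fin (k + 1) → ℕ) (hm : ∀ l, 1 ≤ m l)
    (θ : Fin (k + 1) → ℝ) (hθ : StrictMono θ)
    (hθ_mem : ∀ l, θ l ∈ Set.Ico 0 (2 * Real.pi))
    (c : Fin N → Fin (k + 1)) (hc : ∀ l, Fintype.card {i : Fin N // c i = l} = m l)
    (φ : ℝ) (hφ : φ ∈ Set.Ioo 0 (2 * Real.pi))
    [MeasurableSpace (Matrix.unitaryGroup (Fin N) ℂ)]
    [BorelSpace (Matrix.unitaryGroup (Fin N) ℂ)]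
    (haar : Measure (Matrix.unitaryGroup (Fin N) ℂ)) [haar.IsHaarMeasure]
    [IsProbabilityMeasure haar]
    {Ω : Type*} [MeasurableSpace Ω] (P : Measure Ω) [IsProbabilityMeasure P]
    (U V : Ω → Matrix.unitaryGroup (Fin N) ℂ) (hU : Measurable U) (hV : Measurable V)
    (hU_law : P.map U = haar) (hV_law : P.map V = haar) (hUV : IndepFun U V P) :
    ∃ ψ : Ω → Fin (k + 1) → ℝ, Measurable ψ ∧
      (∀ᵐ ω ∂P,
        (MultHorn.product (MultHorn.diagA θ c) (MultHorn.diagB N (MultHorn.e φ))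
            (U ω) (V ω)).charpoly =
          (∏ l, (Polynomial.X - Polynomial.C (MultHorn.e (θ l))) ^ (m l - 1)) *
            ∏ j, (Polynomial.X - Polynomial.C (MultHorn.e (ψ ω j))) ∧
        (∀ l, (MultHorn.product (MultHorn.diagA θ c) (MultHorn.diagB N (MultHorn.e φ))
            (U ω) (V ω)).charpoly.rootMultiplicity (MultHorn.e (θ l)) = m l - 1) ∧
        MultHorn.Interlaces θ (ψ ω) ∧
        ∏ j, MultHorn.e (ψ ω j) = MultHorn.e φ * ∏ l, MultHorn.e (θ l)) ∧
      P.map ψ = (MultHorn.hyperplaneVolume k (φ - 2 * Real.pi + ∑ l, θ l)).withDensity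
        (MultHorn.eigenDensity m θ (MultHorn.e φ)) := by
  have hS : Spread θ := ⟨hθ, fun i j => by have := (hθ_mem i).2; have := (hθ_mem j).1; linarith⟩
  obtain ⟨s, hs⟩ : ∃ s, s = φ - 2 * Real.pi + ∑ l, θ l := ⟨_, rfl⟩
  have hN0 : 0 < N := by
    have h1 : Nonempty {i : Fin N // c i = 0} :=
      Fintype.card_pos_iff.1 (by rw [hc 0]; exact hm 0)
    exact h1.some.1.pos
  obtain ⟨i₀, hi₀⟩ : ∃ i₀ : Fin N, i₀.val = 0 := ⟨⟨0, hN0⟩, rfl⟩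
  obtain ⟨G, hG, hGinv⟩ := exists_measurable_leftInverse hS hφ hs
  set w : Ω → Fin N → ℂ := fun ω i => ((U ω)⁻¹ * V ω).1 i i₀ with hw
  have hw_meas : Measurable w := by
    refine measurable_pi_iff.2 fun i => ?_
    have h1 : (fun ω => w ω i) = fun ω => ∑ j, star ((U ω).1 j i) * (V ω).1 j i₀ := by
      ext ω
      change ((U ω).1.conjTranspose * (V ω).1) i i₀ = _
      rw [Matrix.mul_apply]
      rfl
    rw [h1]
    exact Finset.measurable_sum _ fun j _ =>
      (continuous_star.measurable.comp ((measurable_entry j i).comp hU)).mul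
        ((measurable_entry j i₀).comp hV)
  set q : Ω → Fin k → ℝ := fun ω => proportions (blockNorms c (w ω)) with hq
  have hq_meas : Measurable q :=
    measurable_proportions.comp ((measurable_blockNorms c).comp hw_meas)
  have hlaw : ∀ F : (Fin k → ℝ) → ENNReal, Measurable F → ∫⁻ ω, F (q ω) ∂P =
      ∫⁻ q in openSimplex k, F q * ENNReal.ofReal (dirichletWeight m (hyperPoint 1 q)) := by
    intro F hF
    rw [← lintegral_weights_column hm hc haar i₀ hF]
    exact lintegral_column_inv_mul hU hV hU_law hV_law hUV i₀
      (f := fun z => F (proportions (blockNorms c z)))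
      (hF.comp (measurable_proportions.comp (measurable_blockNorms c)))
  -- The columns of a unitary matrix are unit vectors, so that normalising changes nothing.
  have hqw : ∀ ω, hyperPoint 1 (q ω) = blockNorms c (w ω) := by
    intro ω
    have h1 : ∑ l, blockNorms c (w ω) l = 1 := by
      rw [sum_blockNorms, ← Complex.ofReal_inj, sum_norm_sq_eq]
      have h2 := Matrix.mem_unitaryGroup_iff'.1 ((U ω)⁻¹ * V ω).2
      have h3 := congrFun (congrFun h2 i₀) i₀
      rw [Matrix.mul_apply, Matrix.one_apply_eq] at h3
      rw [Complex.ofReal_one, ← h3]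
      rfl
    rw [← hyperPoint_init h1]
    congr 1
    ext j
    simp only [hq, proportions, h1, div_one]
  -- The Dirichlet law charges the open simplex only, so almost surely no weight vanishes.
  have hsimplex : ∀ᵐ ω ∂P, q ω ∈ openSimplex k := by
    have h1 := hlaw ((openSimplex k)ᶜ.indicator 1)
      (measurable_one.indicator measurableSet_openSimplex.compl)
    rw [setLIntegral_congr_fun (g := fun _ => 0) measurableSet_openSimplex
      (fun x hx => by rw [Set.indicator_of_notMem (Set.notMem_compl_iff.2 hx), zero_mul]),
      lintegral_zero, lintegral_eq_zero_iff
        (show Measurable fun ω => (openSimplex k)ᶜ.indicator (1 : (Fin k → ℝ) → ENNReal) (q ω) from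
          (measurable_one.indicator measurableSet_openSimplex.compl).comp hq_meas)] at h1
    filter_upwards [h1] with ω hω
    by_contra hcon
    rw [Set.indicator_of_mem (Set.mem_compl hcon)] at hω
    exact one_ne_zero hω
  have hψ_meas : Measurable fun ω => hyperPoint s (G (q ω)) :=
    (continuous_hyperPoint s).measurable.comp (hG.comp hq_meas)
  refine ⟨fun ω => hyperPoint s (G (q ω)), hψ_meas, ?_, ?_⟩
  · filter_upwards [hsimplex] with ω hω
    rw [← image_weightMap hS hφ hs] at hω
    obtain ⟨x, hx, hxq⟩ := hω
    have hI : Interlaces θ (hyperPoint s x) := hx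
    rw [← hxq, hGinv x hx]
    have hchar : (product (diagA θ c) (diagB N (e φ)) (U ω) (V ω)).charpoly =
        (∏ l, (Polynomial.X - Polynomial.C (e (θ l))) ^ (m l - 1)) *
          ∏ j, (Polynomial.X - Polynomial.C (e (hyperPoint s x j))) := by
      rw [charpoly_product hm θ hc (e φ) (U ω) (V ω) hi₀,
        ← secular_weight hS hφ (by rw [sum_hyperPoint, hs]), ← hyperPoint_weightMap hS hφ hs, hxq,
        hqw]
    refine ⟨hchar, fun l => ?_, hI, ?_⟩
    · rw [hchar, ← Finset.mul_prod_erase Finset.univ _ (Finset.mem_univ l), mul_assoc, mul_comm]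
      have hne : Polynomial.eval (e (θ l)) ((∏ i ∈ Finset.univ.erase l,
          (Polynomial.X - Polynomial.C (e (θ i))) ^ (m i - 1)) *
          ∏ j, (Polynomial.X - Polynomial.C (e (hyperPoint s x j)))) ≠ 0 := by
        simp only [Polynomial.eval_mul, Polynomial.eval_prod, Polynomial.eval_pow,
          Polynomial.eval_sub, Polynomial.eval_X, Polynomial.eval_C]
        refine mul_ne_zero (Finset.prod_ne_zero_iff.2 fun i hi => pow_ne_zero _ (sub_ne_zero.2 ?_))
          (Finset.prod_ne_zero_iff.2 fun j _ => sub_ne_zero.2 (hI.e_ne hS l j))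
        exact fun h => Finset.ne_of_mem_erase hi (hS.injective_e h).symm
      rw [Polynomial.rootMultiplicity_mul_X_sub_C_pow fun h => hne (by rw [h]; simp),
        Polynomial.rootMultiplicity_eq_zero hne, zero_add]
    · rw [← e_sum, ← e_sum, sum_hyperPoint, hs, ← e_add]
      exact e_eq_e_iff.2 ⟨-1, by push_cast; ring⟩
  · rw [← hs]
    ext S hSm
    have hvol : hyperplaneVolume k s = volume.map (hyperPoint s) := rfl
    have hind : Measurable fun x : Fin k → ℝ => S.indicator (1 : (Fin (k + 1) → ℝ) → ENNReal)
        (hyperPoint s (G x)) :=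
      (measurable_one.indicator hSm).comp ((continuous_hyperPoint s).measurable.comp hG)
    rw [withDensity_apply _ hSm, ← lintegral_indicator hSm, hvol,
      lintegral_map ((measurable_eigenDensity m θ _).indicator hSm)
        (continuous_hyperPoint s).measurable, ← lintegral_indicator_one hSm,
      lintegral_map (measurable_one.indicator hSm) hψ_meas, hlaw _ hind,
      setLIntegral_openSimplex hm hS hφ hs]
    refine lintegral_congr fun x => ?_
    by_cases hx : x ∈ interlacingRegion θ s
    · rw [hGinv x hx]
      by_cases hxS : hyperPoint s x ∈ S
      · rw [Set.indicator_of_mem hxS, Set.indicator_of_mem hxS, Pi.one_apply, one_mul]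
      · rw [Set.indicator_of_notMem hxS, Set.indicator_of_notMem hxS, zero_mul]
    · have h0 : eigenDensity m θ (e φ) (hyperPoint s x) = 0 := if_neg hx
      rw [h0, mul_zero]
      exact (Set.indicator_apply_eq_zero.2 fun _ => h0).symm
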